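/- Fix an integer $k\ge 2$ and a real $\alpha>0$, and put $q:=k^{-\alpha}\in(0,1)$, $\gamma:=\log k$ and $\varphi_\infty(q):=\prod_{i=1}^\infty(1-q^i)$. Let $\mathbb T$ be the infinite rooted $k$-ary tree, let $|v|$ be the generation of $v\in\mathbb T$ (the root having generation $0$), and let $\mathbb T_n$ be the set of the $k^n$ vertices of generation $n$. Let $(W^{(v)})_{v\in\mathbb T}$ be independent standard exponential random variables. Define $S(\mathrm{root}):=W^{(\mathrm{root})}$ and $S(w):=S(v)+q^{-|w|}W^{(w)}$ whenever $w$ is a child of $v$, and set $K(v):=q^{|v|}S(v)$. For $n\ge 0$ let $$N_n:=\sum_{v\in\mathbb T_n}\delta_{K(v)-\gamma n},$$ a point process on $\mathbb R$, regarded as a random element of the space of locally finite Borel measures on $\mathbb R$ with the vague topology (the coarsest topology for which $\mu\mapsto\int f\,d\mu$ is continuous for every continuous compactly supported $f:\mathbb R\to\mathbb R$). Then, as $n\to\infty$, $N_n$ converges in distribution to a Poisson point process on $\mathbb R$ with intensity measure $$\frac{e^{-s}}{\varphi_\infty(q)}\,ds .$$ Moreover, for every integer $\ell\ge 1$, the vector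 $(N_n,\dots,N_{n+\ell-1})$ converges in distribution, as $n\to\infty$ (for the product of the vague topologies), to a vector of $\ell$ independent Poisson point processes on $\mathbb R$, each with this intensity measure. -/

import Mathlib

open MeasureTheory ProbabilityTheory Filter Topology
open scoped CompactlySupported ENNReal NNReal

namespace Fragmentation

noncomputable section

/-! ### Locally finite measures on the real line, with the vague topology -/

/-- The space of locally finite Borel measures on the real line. -/
def LFMeasure : Type := {μ : Measure ℝ // IsLocallyFiniteMeasure μ}

namespace LFMeasure

/-- The underlying measure. -/
def toMeasure (μ : LFMeasure) : Measure ℝ := μ.1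

instance (μ : LFMeasure) : IsLocallyFiniteMeasure μ.toMeasure := μ.2

/-- The usual σ-algebra on the space of measures: the coarsest one for which `μ ↦ μ A` is
measurable for every Borel set `A`. -/
instance : MeasurableSpace LFMeasure :=
  MeasurableSpace.comap toMeasure Measure.instMeasurableSpace

/-- The vague topology: the coarsest one for which `μ ↦ ∫ f dμ` is continuous for every
continuous compactly supported `f`. -/
instance : TopologicalSpace LFMeasure :=
  TopologicalSpace.induced (fun μ (f : C_c(ℝ, ℝ)) => ∫ x, f x ∂μ.toMeasure) inferInstance

theorem measurable_toMeasure : Measurable toMeasure := comap_measurable _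

theorem integrable (μ : LFMeasure) (f : C_c(ℝ, ℝ)) : Integrable f μ.toMeasure :=
  f.continuous.integrable_of_hasCompactSupport f.hasCompactSupport

theorem continuous_integral (f : C_c(ℝ, ℝ)) :
    Continuous fun μ : LFMeasure => ∫ x, f x ∂μ.toMeasure :=
  continuous_pi_iff.1 (continuous_induced_dom
    (f := fun (μ : LFMeasure) (f : C_c(ℝ, ℝ)) => ∫ x, f x ∂μ.toMeasure)) f

/-- Piecewise linear cut-off functions, equal to one on `[-n, n]`. -/
def cutoff (n : ℕ) : C_c(ℝ, ℝ) where
  toFun x := max 0 (min 1 ((n : ℝ) + 1 - |x|))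
  continuous_toFun := by fun_prop
  hasCompactSupport' := by
    refine HasCompactSupport.intro (isCompact_Icc (a := -((n : ℝ) + 1)) (b := (n : ℝ) + 1)) ?_
    intro x hx
    have : ¬ |x| ≤ (n : ℝ) + 1 := fun h => hx (abs_le.1 h)
    apply max_eq_left
    exact (min_le_right _ _).trans (by linarith)

theorem cutoff_apply (n : ℕ) (x : ℝ) : cutoff n x = max 0 (min 1 ((n : ℝ) + 1 - |x|)) := rfl

theorem cutoff_nonneg (n : ℕ) (x : ℝ) : 0 ≤ cutoff n x := le_max_left _ _

theorem cutoff_eq_one {n : ℕ} {x : ℝ} (h : |x| ≤ n) : cutoff n x = 1 := by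
  rw [cutoff_apply, min_eq_left (by linarith), max_eq_right zero_le_one]

/-- A continuous function cut off to have compact support. -/
def cut (n : ℕ) (g : C(ℝ, ℝ)) : C_c(ℝ, ℝ) where
  toFun x := cutoff n x * g x
  continuous_toFun := (cutoff n).continuous.mul g.continuous
  hasCompactSupport' := (cutoff n).hasCompactSupport.mul_right

theorem cut_apply (n : ℕ) (g : C(ℝ, ℝ)) (x : ℝ) : cut n g x = cutoff n x * g x := rfl

/-- A countable family of test functions. -/
def testFamily : ℕ ⊕ (ℕ × ℕ) → C_c(ℝ, ℝ)
  | Sum.inl n => cutoff n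
  | Sum.inr p => cut p.1 (TopologicalSpace.denseSeq C(ℝ, ℝ) p.2)

theorem exists_test (f : C_c(ℝ, ℝ)) : ∃ n : ℕ, ∀ δ > 0, ∃ j : ℕ, ∀ x,
    |f x - testFamily (Sum.inr (n, j)) x| ≤ δ * cutoff n x := by
  obtain ⟨R, hR⟩ := f.hasCompactSupport.isCompact.isBounded.subset_closedBall (0 : ℝ)
  obtain ⟨n, hn⟩ := exists_nat_ge R
  have hf : ∀ x, f x = cutoff n x * f x := by
    intro x
    by_cases hx : x ∈ tsupport f
    · have : |x| ≤ n := by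
        have := hR hx
        rw [Metric.mem_closedBall, Real.dist_eq, sub_zero] at this
        linarith
      rw [cutoff_eq_one this, one_mul]
    · rw [image_eq_zero_of_notMem_tsupport hx, mul_zero]
  refine ⟨n, fun δ hδ => ?_⟩
  have hK : IsCompact (tsupport (cutoff n)) := (cutoff n).hasCompactSupport
  have hU : ∀ᶠ g : C(ℝ, ℝ) in 𝓝 f.toContinuousMap, ∀ x ∈ tsupport (cutoff n), dist (f x) (g x) < δ :=
    (Metric.tendstoUniformlyOn_iff.1
      (ContinuousMap.tendsto_iff_forall_isCompact_tendstoUniformlyOn.1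
        (tendsto_id (x := 𝓝 f.toContinuousMap)) _ hK)) δ hδ
  obtain ⟨_, ⟨j, rfl⟩, hg⟩ := (TopologicalSpace.denseRange_denseSeq C(ℝ, ℝ)).inter_nhds_nonempty hU
  refine ⟨j, fun x => ?_⟩
  have hx : f x - testFamily (Sum.inr (n, j)) x
      = cutoff n x * (f x - TopologicalSpace.denseSeq C(ℝ, ℝ) j x) := by
    rw [mul_sub, ← hf]; rfl
  rw [hx, abs_mul, abs_of_nonneg (cutoff_nonneg n x), mul_comm δ]
  by_cases hxs : x ∈ tsupport (cutoff n)
  · exact mul_le_mul_of_nonneg_left (hg x hxs).le (cutoff_nonneg n x)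
  · rw [image_eq_zero_of_notMem_tsupport hxs]; simp

theorem abs_integral_sub_le (μ : LFMeasure) (f g : C_c(ℝ, ℝ)) (n : ℕ) (δ : ℝ)
    (h : ∀ x, |f x - g x| ≤ δ * cutoff n x) :
    |∫ x, f x ∂μ.toMeasure - ∫ x, g x ∂μ.toMeasure| ≤ δ * ∫ x, cutoff n x ∂μ.toMeasure := by
  rw [← integral_sub (μ.integrable f) (μ.integrable g), ← integral_const_mul]
  rw [← Real.norm_eq_abs]
  exact norm_integral_le_of_norm_le ((μ.integrable _).const_mul δ)
    (Eventually.of_forall fun x => by rw [Real.norm_eq_abs]; exact h x)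

theorem topology_eq_induced : instTopologicalSpace =
    TopologicalSpace.induced (fun μ i => ∫ x, testFamily i x ∂μ.toMeasure) inferInstance := by
  apply le_antisymm
  · rw [← continuous_iff_le_induced]
    exact continuous_pi fun i => continuous_integral _
  · let t : TopologicalSpace LFMeasure :=
      TopologicalSpace.induced (fun μ i => ∫ x, testFamily i x ∂μ.toMeasure) inferInstance
    have hc : ∀ i, @Continuous _ _ t _
        (fun μ : LFMeasure => ∫ x, testFamily i x ∂μ.toMeasure) := fun i =>
      continuous_pi_iff.1 (@continuous_induced_dom _ _
        (fun (μ : LFMeasure) i => ∫ x, testFamily i x ∂μ.toMeasure) _) i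
    refine continuous_iff_le_induced.1 (continuous_pi fun f => ?_)
    obtain ⟨n, hn⟩ := exists_test f
    rw [continuous_iff_continuousAt]
    intro μ₀
    refine Metric.tendsto_nhds.2 fun ε hε => ?_
    set M : ℝ := (∫ x, cutoff n x ∂μ₀.toMeasure) + 1 with hM
    have hpos : ∀ μ : LFMeasure, 0 ≤ ∫ x, cutoff n x ∂μ.toMeasure := fun μ =>
      integral_nonneg (cutoff_nonneg n)
    have hM0 : 0 < M := by have := hpos μ₀; linarith
    obtain ⟨j, hj⟩ := hn (ε / (4 * M)) (by positivity)
    have h1 : ∀ᶠ μ in 𝓝 μ₀, ∫ x, cutoff n x ∂μ.toMeasure < M :=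
      ((hc (Sum.inl n)).tendsto μ₀).eventually_lt_const (by rw [hM]; exact lt_add_one _)
    have h2 := Metric.tendsto_nhds.1 ((hc (Sum.inr (n, j))).tendsto μ₀) (ε / 4) (by positivity)
    have key : ∀ μ : LFMeasure, ∫ x, cutoff n x ∂μ.toMeasure < M →
        |∫ x, f x ∂μ.toMeasure - ∫ x, testFamily (Sum.inr (n, j)) x ∂μ.toMeasure| ≤ ε / 4 := by
      intro μ hμ
      refine (abs_integral_sub_le μ f _ n _ hj).trans ?_
      calc ε / (4 * M) * ∫ x, cutoff n x ∂μ.toMeasure ≤ ε / (4 * M) * M := by gcongr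
        _ = ε / 4 := by field_simp
    filter_upwards [h1, h2] with μ hμ1 hμ2
    have k1 := abs_le.1 (key μ hμ1)
    have k2 := abs_le.1 (key μ₀ (by rw [hM]; exact lt_add_one _))
    rw [Real.dist_eq] at hμ2 ⊢
    have k3 := abs_lt.1 hμ2
    rw [abs_lt]
    constructor <;> linarith [k1.1, k1.2, k2.1, k2.2, k3.1, k3.2]

instance : SecondCountableTopology LFMeasure := by
  rw [topology_eq_induced]
  exact TopologicalSpace.secondCountableTopology_induced _ _ _

theorem measurable_integral (f : C_c(ℝ, ℝ)) :
    Measurable fun μ : LFMeasure => ∫ x, f x ∂μ.toMeasure := by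
  have h : ∀ g : ℝ → ℝ, Measurable g →
      Measurable fun μ : LFMeasure => (∫⁻ x, ENNReal.ofReal (g x) ∂μ.toMeasure).toReal :=
    fun g hg => ((Measure.measurable_lintegral hg.ennreal_ofReal).comp
      measurable_toMeasure).ennreal_toReal
  have hf : Measurable f := f.continuous.measurable
  have e : (fun μ : LFMeasure => ∫ x, f x ∂μ.toMeasure) = fun μ : LFMeasure =>
      (∫⁻ x, ENNReal.ofReal (f x) ∂μ.toMeasure).toReal
        - (∫⁻ x, ENNReal.ofReal (-f x) ∂μ.toMeasure).toReal := by
    funext μ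
    exact integral_eq_lintegral_pos_part_sub_lintegral_neg_part (μ.integrable f)
  rw [e]
  exact (h _ hf).sub (h _ hf.neg)

/-- Vaguely open sets are measurable. -/
instance : OpensMeasurableSpace LFMeasure where
  borel_le := by
    have hm : Measurable fun (μ : LFMeasure) i => ∫ x, testFamily i x ∂μ.toMeasure :=
      measurable_pi_iff.2 fun i => measurable_integral _
    refine MeasurableSpace.generateFrom_le fun s hs => ?_
    have hs' : IsOpen[instTopologicalSpace] s := hs
    rw [topology_eq_induced, isOpen_induced_iff] at hs'
    obtain ⟨u, hu, rfl⟩ := hs'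
    exact hm hu.measurableSet

end LFMeasure

/-! ### Poisson point processes -/

/-- The Poisson distribution with mean `r ∈ [0, ∞]`, as a law on `[0, ∞]`; for `r = ∞` it is the
point mass at `∞`. -/
def poissonLaw (r : ℝ≥0∞) : Measure ℝ≥0∞ :=
  if r = ∞ then Measure.dirac ∞
  else (poissonMeasure r.toNNReal).map (fun j : ℕ => (j : ℝ≥0∞))

/-- `Z` is a Poisson point process on the real line with intensity measure `ν`, defined on the
probability space `(Ω, P)`: a random locally finite measure such that the mass of each Borel set
`A` is Poisson distributed with mean `ν A`, and the masses of finitely many pairwise disjoint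
Borel sets are independent. -/
structure IsPoissonProcess {Ω : Type*} [MeasurableSpace Ω] (Z : Ω → LFMeasure) (ν : Measure ℝ)
    (P : Measure Ω) : Prop where
  aemeasurable : AEMeasurable Z P
  hasLaw : ∀ A : Set ℝ, MeasurableSet A →
    HasLaw (fun ω => (Z ω).toMeasure A) (poissonLaw (ν A)) P
  indep : ∀ (m : ℕ) (A : Fin m → Set ℝ), (∀ i, MeasurableSet (A i)) →
    Pairwise (fun i j => Disjoint (A i) (A j)) →
    iIndepFun (fun (i : Fin m) ω => (Z ω).toMeasure (A i)) P

/-! ### The rescaled expanding branching random walk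

The vertices of the `k`-ary tree are the finite words over `Fin k`: the root is the empty word,
generation `n` consists of the words of length `n`, and the children of `v` are the words `i :: v`.
The vertex `v` stands for the subinterval of `[0, 1)` of length `k ^ (-|v|)` whose position is read
off from the base-`k` digits in `v`. -/

/-- The time at which the interval `v` breaks: the root breaks at time `W root`, and a child `w` of
`v` breaks a time `q ^ (-|w|) * W w` after `v`. -/
def splitTime {k : ℕ} (q : ℝ) (W : List (Fin k) → ℝ) : List (Fin k) → ℝ
  | [] => W []
  | i :: v => splitTime q W v + (q ^ (v.length + 1))⁻¹ * W (i :: v)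

/-- The rescaled position `K(v) = q ^ |v| * S(v)`. -/
def rescaled {k : ℕ} (q : ℝ) (W : List (Fin k) → ℝ) (v : List (Fin k)) : ℝ :=
  q ^ v.length * splitTime q W v

/-- The point measure `N_n = ∑_{|v| = n} δ_{K(v) - n log k}`. -/
def pointProcess {k : ℕ} (q : ℝ) (W : List (Fin k) → ℝ) (n : ℕ) : LFMeasure :=
  ⟨∑ v : List.Vector (Fin k) n,
    Measure.dirac (rescaled q W v.toList - (n : ℝ) * Real.log k), inferInstance⟩

/-- The Euler function `∏_{i ≥ 1} (1 - q ^ i)`. -/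
def eulerFunction (q : ℝ) : ℝ := ∏' i : ℕ, (1 - q ^ (i + 1))

/-- The measure with density `e ^ (-s) / φ_∞(q)`. -/
def intensity (q : ℝ) : Measure ℝ :=
  volume.withDensity fun s => ENNReal.ofReal (Real.exp (-s) / eulerFunction q)

end

end Fragmentation

namespace Fragmentation

/-! ### Convergence in distribution in a space carrying an initial topology -/

/-- If the topology of `E` is induced by countably many real functions, then convergence of
the characteristic functions of all finite subfamilies implies convergence in distribution. -/
theorem tendstoInDistribution_of_isInducing {E I Ω Ω' : Type*} [TopologicalSpace E]
    [MeasurableSpace E] [OpensMeasurableSpace E] [Countable I] [MeasurableSpace Ω]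
    [MeasurableSpace Ω'] {P : Measure Ω} [IsProbabilityMeasure P] {P' : Measure Ω'}
    [IsProbabilityMeasure P'] (φ : E → I → ℝ) (hφ : IsInducing φ) (X : ℕ → Ω → E) (Z : Ω' → E)
    (hX : ∀ n, AEMeasurable (X n) P) (hZ : AEMeasurable Z P')
    (h : ∀ (J : Finset I) (t : I → ℝ), Tendsto
      (fun n => ∫ ω, Complex.exp ((∑ i ∈ J, t i * φ (X n ω) i : ℝ) * Complex.I) ∂P) atTop
      (𝓝 (∫ ω, Complex.exp ((∑ i ∈ J, t i * φ (Z ω) i : ℝ) * Complex.I) ∂P'))) :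
    TendstoInDistribution X atTop Z (fun _ => P) P' := by
  classical
  refine ⟨hX, hZ, ?_⟩
  have hproj : ∀ i, Continuous fun x => φ x i := fun i => continuous_pi_iff.1 hφ.continuous i
  let Φ : ∀ J : Finset I, E → EuclideanSpace ℝ J := fun J x => WithLp.toLp 2 fun i => φ x i
  have hΦ : ∀ J, Continuous (Φ J) := fun J =>
    (PiLp.continuous_toLp 2 _).comp (continuous_pi fun i => hproj i)
  have hm : ∀ J n, AEMeasurable (Φ J ∘ X n) P := fun J n =>
    (hΦ J).measurable.comp_aemeasurable (hX n)
  have hmZ : ∀ J, AEMeasurable (Φ J ∘ Z) P' := fun J =>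
    (hΦ J).measurable.comp_aemeasurable hZ
  have hfin : ∀ J : Finset I, Tendsto (β := ProbabilityMeasure (EuclideanSpace ℝ J))
      (fun n => ⟨P.map (Φ J ∘ X n), Measure.isProbabilityMeasure_map (hm J n)⟩) atTop
      (𝓝 ⟨P'.map (Φ J ∘ Z), Measure.isProbabilityMeasure_map (hmZ J)⟩) := by
    intro J
    refine ProbabilityMeasure.tendsto_of_tendsto_charFun fun t => ?_
    have hc : Continuous fun x : EuclideanSpace ℝ J =>
        Complex.exp ((inner ℝ x t : ℝ) * Complex.I) := by fun_prop
    have key := h J fun i => if hi : i ∈ J then t ⟨i, hi⟩ else 0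
    have e : ∀ x : E, (∑ i ∈ J, (if hi : i ∈ J then t ⟨i, hi⟩ else 0) * φ x i)
        = inner ℝ (Φ J x) t := by
      intro x
      rw [PiLp.inner_apply, ← Finset.sum_attach]
      refine Finset.sum_congr rfl fun i _ => ?_
      simp [Φ]
    simp only [e] at key
    simp only [charFun_apply, ProbabilityMeasure.coe_mk]
    rw [integral_map (hmZ J) hc.aestronglyMeasurable]
    simp_rw [integral_map (hm J _) hc.aestronglyMeasurable]
    exact key
  refine tendsto_of_forall_isOpen_le_liminf' fun G hG => ?_
  let V : ∀ J : Finset I, Set (EuclideanSpace ℝ J) := fun J =>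
    ⋃₀ {U | IsOpen U ∧ Φ J ⁻¹' U ⊆ G}
  have hV : ∀ J, IsOpen (V J) := fun J => isOpen_sUnion fun U hU => hU.1
  have hVG : ∀ J, Φ J ⁻¹' V J ⊆ G := by
    rintro J x ⟨U, hU, hx⟩
    exact hU.2 hx
  have hmono : Monotone fun J => Φ J ⁻¹' V J := by
    rintro J J' hJ x ⟨U, hU, hx⟩
    let r : EuclideanSpace ℝ J' → EuclideanSpace ℝ J := fun y =>
      WithLp.toLp 2 fun i => y ⟨i, hJ i.2⟩
    have hr : Continuous r := (PiLp.continuous_toLp 2 _).comp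
      (continuous_pi fun i => by fun_prop)
    exact ⟨r ⁻¹' U, ⟨hU.1.preimage hr, hU.2⟩, hx⟩
  have hcover : (⋃ J, Φ J ⁻¹' V J) = G := by
    refine Set.Subset.antisymm (Set.iUnion_subset hVG) fun x hx => ?_
    obtain ⟨O, hO, rfl⟩ := hφ.isOpen_iff.1 hG
    obtain ⟨J, u, hu, hsub⟩ := isOpen_pi_iff.1 hO (φ x) hx
    refine Set.mem_iUnion.2 ⟨J, {y | ∀ i : J, y i ∈ u i}, ⟨?_, ?_⟩, fun i => (hu i i.2).2⟩
    · simp only [Set.ofPred_forall]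
      exact isOpen_iInter_of_finite fun i => (hu i i.2).1.preimage (by fun_prop)
    · intro y hy
      exact hsub fun i hi => hy ⟨i, hi⟩
  have hsup : P'.map Z G = ⨆ J, P'.map Z (Φ J ⁻¹' V J) := by
    rw [← (hmono.directed_le).measure_iUnion, hcover]
  change P'.map Z G ≤ liminf (fun n => P.map (X n) G) atTop
  rw [hsup]
  refine iSup_le fun J => ?_
  have h1 := ProbabilityMeasure.le_liminf_measure_open_of_tendsto (hfin J) (hV J)
  simp only [ProbabilityMeasure.coe_mk] at h1
  rw [← AEMeasurable.map_map_of_aemeasurable (hΦ J).aemeasurable hZ,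
    Measure.map_apply (hΦ J).measurable (hV J).measurableSet] at h1
  refine h1.trans (liminf_le_liminf (Eventually.of_forall fun n => ?_))
  rw [← AEMeasurable.map_map_of_aemeasurable (hΦ J).aemeasurable (hX n),
    Measure.map_apply (hΦ J).measurable (hV J).measurableSet]
  exact measure_mono (hVG J)

/-- A finite linear combination of test functions is a test function. -/
theorem exists_integral_eq_sum {I : Type*} (J : Finset I) (c : I → ℝ) (f : I → C_c(ℝ, ℝ)) :
    ∃ g : C_c(ℝ, ℝ), ∀ μ : LFMeasure,
      ∫ x, g x ∂μ.toMeasure = ∑ i ∈ J, c i * ∫ x, f i x ∂μ.toMeasure := by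
  classical
  induction J using Finset.induction_on with
  | empty => exact ⟨0, fun μ => by simp⟩
  | insert i s hi ih =>
    obtain ⟨g, hg⟩ := ih
    refine ⟨c i • f i + g, fun μ => ?_⟩
    rw [Finset.sum_insert hi, ← hg, ← integral_const_mul, ← integral_add
      ((μ.integrable _).const_mul _) (μ.integrable _)]
    rfl

/-- Convergence in distribution of vectors of random locally finite measures follows from
convergence of the characteristic functionals; the vectors are given through an inducing map. -/
theorem tendstoInDistribution_of_characteristic {Ω Ω' : Type*} [MeasurableSpace Ω]
    [MeasurableSpace Ω'] {P : Measure Ω} [IsProbabilityMeasure P] {P' : Measure Ω'}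
    [IsProbabilityMeasure P'] {ℓ : ℕ} {E : Type*} [TopologicalSpace E]
    [MeasurableSpace E] [OpensMeasurableSpace E] {e : E → Fin ℓ → LFMeasure} (he : IsInducing e)
    (X : ℕ → Ω → E) (Z : Ω' → E)
    (hX : ∀ n, AEMeasurable (X n) P) (hZ : AEMeasurable Z P')
    (h : ∀ g : Fin ℓ → C_c(ℝ, ℝ), Tendsto
      (fun n => ∫ ω, Complex.exp ((∑ i, ∫ x, g i x ∂(e (X n ω) i).toMeasure : ℝ) * Complex.I) ∂P)
      atTop
      (𝓝 (∫ ω, Complex.exp ((∑ i, ∫ x, g i x ∂(e (Z ω) i).toMeasure : ℝ) * Complex.I) ∂P'))) :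
    TendstoInDistribution X atTop Z (fun _ => P) P' := by
  classical
  let φ : (Fin ℓ → LFMeasure) → Fin ℓ × (ℕ ⊕ (ℕ × ℕ)) → ℝ := fun μ p =>
    ∫ x, LFMeasure.testFamily p.2 x ∂(μ p.1).toMeasure
  have hφ : IsInducing φ := by
    refine ⟨?_⟩
    simp only [Pi.topologicalSpace, LFMeasure.topology_eq_induced, induced_iInf, induced_compose,
      iInf_prod]
    rfl
  refine tendstoInDistribution_of_isInducing (φ ∘ e) (hφ.comp he) X Z hX hZ fun J t => ?_
  have hg : ∀ i, ∃ g : C_c(ℝ, ℝ), ∀ μ : LFMeasure, ∫ x, g x ∂μ.toMeasure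
      = ∑ p ∈ J with p.1 = i, t p * ∫ x, LFMeasure.testFamily p.2 x ∂μ.toMeasure := fun i =>
    exists_integral_eq_sum _ t fun p => LFMeasure.testFamily p.2
  choose g hg using hg
  have hsum : ∀ μ : Fin ℓ → LFMeasure, ∑ p ∈ J, t p * φ μ p = ∑ i, ∫ x, g i x ∂(μ i).toMeasure := by
    intro μ
    rw [← Finset.sum_fiberwise J Prod.fst]
    refine Finset.sum_congr rfl fun i _ => ?_
    rw [hg]
    refine Finset.sum_congr rfl fun p hp => ?_
    rw [← (Finset.mem_filter.1 hp).2]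
  simp_rw [Function.comp, hsum]
  exact h g

/-! ### The characteristic functional of a Poisson process -/

theorem integral_exp_poissonLaw {r : ℝ≥0∞} (hr : r ≠ ∞) (y : ℝ) :
    ∫ x, Complex.exp ((y * x.toReal : ℝ) * Complex.I) ∂(poissonLaw r)
      = Complex.exp (r.toReal * (Complex.exp (y * Complex.I) - 1)) := by
  have h1 : Measurable fun x : ℝ≥0∞ => Complex.exp ((y * x.toReal : ℝ) * Complex.I) := by
    fun_prop
  have h := charFun_map_cast_poissonMeasure r.toNNReal y
  rw [charFun_apply, integral_map (by fun_prop) (by fun_prop)] at h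
  rw [poissonLaw, if_neg hr, integral_map (by fun_prop) h1.aestronglyMeasurable]
  convert h using 2
  · funext j
    simp [mul_comm]
  · rfl

theorem integrable_restrict_simpleFunc {E : Type*} [NormedAddCommGroup E] {μ : Measure ℝ}
    [IsLocallyFiniteMeasure μ]
    {K : Set ℝ} (hK : IsCompact K) (s : SimpleFunc ℝ E) : Integrable (s.restrict K) μ := by
  rw [SimpleFunc.coe_restrict _ hK.measurableSet, integrable_indicator_iff hK.measurableSet]
  have : IsFiniteMeasure (μ.restrict K) := ⟨by simpa using hK.measure_lt_top⟩
  exact SimpleFunc.integrable_of_isFiniteMeasure s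

theorem preimage_restrict_subset {E : Type*} [Zero E] {K : Set ℝ} (hK : IsCompact K)
    (s : SimpleFunc ℝ E) {y : E} (hy : y ≠ 0) : s.restrict K ⁻¹' {y} ⊆ K := by
  intro x hx
  by_contra hxK
  apply hy
  rw [← show s.restrict K x = y from hx, SimpleFunc.restrict_apply _ hK.measurableSet,
    Set.indicator_of_notMem hxK]

theorem integral_restrict_simpleFunc {μ : Measure ℝ} [IsLocallyFiniteMeasure μ] {K : Set ℝ}
    (hK : IsCompact K) (s : SimpleFunc ℝ ℝ) : ∫ x, s.restrict K x ∂μ =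
      ∑ y ∈ (s.restrict K).range with y ≠ 0, y * (μ (s.restrict K ⁻¹' {y})).toReal := by
  rw [← SimpleFunc.integral_eq_integral _ (integrable_restrict_simpleFunc hK s),
    SimpleFunc.integral_eq_sum_of_subset (s := {y ∈ (s.restrict K).range | y ≠ 0})
      (Finset.Subset.refl _)]
  exact Finset.sum_congr rfl fun y _ => by rw [smul_eq_mul, mul_comm]; rfl

theorem integral_comp_restrict_simpleFunc {μ : Measure ℝ} [IsLocallyFiniteMeasure μ] {K : Set ℝ}
    (hK : IsCompact K) (s : SimpleFunc ℝ ℝ) (h : ℝ → ℂ) (h0 : h 0 = 0) :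
    ∫ x, h (s.restrict K x) ∂μ =
      ∑ y ∈ (s.restrict K).range with y ≠ 0, (μ (s.restrict K ⁻¹' {y})).toReal * h y := by
  have hi := integrable_restrict_simpleFunc (μ := μ) hK s
  have e := SimpleFunc.map_integral (s.restrict K) h hi h0
  have hi' : Integrable ((s.restrict K).map h) μ := by
    have : (s.restrict K).map h = (s.map h).restrict K := by
      ext x
      rw [SimpleFunc.map_apply, SimpleFunc.restrict_apply _ hK.measurableSet,
        SimpleFunc.restrict_apply _ hK.measurableSet]
      by_cases hx : x ∈ K <;> simp [hx, h0]
    rw [this]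
    exact integrable_restrict_simpleFunc hK _
  rw [SimpleFunc.integral_eq_integral _ hi'] at e
  refine e.trans ?_
  rw [Finset.sum_filter]
  refine Finset.sum_congr rfl fun y _ => ?_
  split_ifs with hy
  · simp [Measure.real]
  · rw [not_not.1 hy, h0, smul_zero]

section CharacteristicFunctional

variable {Ω : Type*} [MeasurableSpace Ω] {Z : Ω → LFMeasure} {ν : Measure ℝ} {P : Measure Ω}

theorem IsPoissonProcess.characteristic_simpleFunc [IsLocallyFiniteMeasure ν]
    (hZ : IsPoissonProcess Z ν P) {K : Set ℝ} (hK : IsCompact K) (s : SimpleFunc ℝ ℝ) :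
    ∫ ω, Complex.exp ((∫ x, s.restrict K x ∂(Z ω).toMeasure : ℝ) * Complex.I) ∂P
      = Complex.exp (∫ x, (Complex.exp (s.restrict K x * Complex.I) - 1) ∂ν) := by
  classical
  set F : Finset ℝ := {y ∈ (s.restrict K).range | y ≠ 0} with hF
  let A : ℝ → Set ℝ := fun y => s.restrict K ⁻¹' {y}
  have hA : ∀ y, MeasurableSet (A y) := fun y => SimpleFunc.measurableSet_preimage _ _
  have hind : iIndepFun (fun (y : F) ω => (Z ω).toMeasure (A y)) P := by
    have h1 := hZ.indep F.card (fun i => A (F.equivFin.symm i)) (fun i => hA _) ?_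
    · have h2 := h1.precomp F.equivFin.injective
      simpa using h2
    · intro i j hij
      refine Set.disjoint_left.2 fun x hx hx' => hij ?_
      exact F.equivFin.symm.injective (Subtype.ext (hx.symm.trans hx'))
  have hlaw := fun y => hZ.hasLaw (A y) (hA y)
  have hfin : ∀ y ∈ F, ν (A y) ≠ ∞ := fun y hy =>
    ((measure_mono (preimage_restrict_subset hK s (Finset.mem_filter.1 hy).2)).trans_lt
      hK.measure_lt_top).ne
  simp_rw [integral_restrict_simpleFunc hK s]
  rw [integral_comp_restrict_simpleFunc hK s (fun y => Complex.exp (y * Complex.I) - 1) (by simp)]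
  rw [← hF, Complex.exp_sum]
  have e : ∀ ω, Complex.exp ((∑ y ∈ F, y * ((Z ω).toMeasure (A y)).toReal : ℝ) * Complex.I)
      = ∏ y : F, (fun x : ℝ≥0∞ => Complex.exp ((y * x.toReal : ℝ) * Complex.I))
        ((Z ω).toMeasure (A y)) := by
    intro ω
    rw [Complex.ofReal_sum, Finset.sum_mul, Complex.exp_sum,
      Finset.prod_coe_sort F (fun y => Complex.exp ((y * ((Z ω).toMeasure (A y)).toReal : ℝ)
        * Complex.I))]
  change ∫ ω, Complex.exp ((∑ y ∈ F, y * ((Z ω).toMeasure (A y)).toReal : ℝ) * Complex.I) ∂P = _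
  simp_rw [e]
  have hmeas : ∀ y : ℝ, Measurable fun x : ℝ≥0∞ =>
    Complex.exp ((y * x.toReal : ℝ) * Complex.I) := fun y => by fun_prop
  rw [hind.integral_fun_prod_comp (fun y => (hlaw y).aemeasurable)
    (fun y => (hmeas y).aestronglyMeasurable), ← Finset.prod_coe_sort F]
  refine Finset.prod_congr rfl fun y _ => ?_
  rw [← integral_exp_poissonLaw (hfin y y.2) y, ← (hlaw y).integral_comp
    (hmeas y).aestronglyMeasurable]
  rfl

theorem tendsto_integral_restrict_approx {E : Type*} [NormedAddCommGroup E] [NormedSpace ℝ E]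
    {μ : Measure ℝ} [IsLocallyFiniteMeasure μ] {K : Set ℝ}
    (hK : IsCompact K) {s : ℕ → ℝ → ℝ}
    {g : ℝ → ℝ} {h : ℝ → E} (hh : Continuous h) {c : ℝ} (hc : ∀ n x, ‖h (s n x)‖ ≤ c)
    (h0 : ∀ n, ∀ x ∉ K, h (s n x) = 0) (hg : ∀ x, Tendsto (fun n => s n x) atTop (𝓝 (g x)))
    (hm : ∀ n, AEStronglyMeasurable (fun x => h (s n x)) μ) :
    Tendsto (fun n => ∫ x, h (s n x) ∂μ) atTop (𝓝 (∫ x, h (g x) ∂μ)) := by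
  refine tendsto_integral_of_dominated_convergence (K.indicator fun _ => c) hm ?_ ?_ ?_
  · rw [integrable_indicator_iff hK.measurableSet]
    exact integrableOn_const hK.measure_lt_top.ne
  · refine fun n => Eventually.of_forall fun x => ?_
    by_cases hx : x ∈ K
    · simpa [hx] using hc n x
    · simp [hx, h0 n x hx]
  · exact Eventually.of_forall fun x => (hh.tendsto _).comp (hg x)

theorem norm_exp_ofReal_mul_I_sub_one_le (x : ℝ) : ‖Complex.exp (x * Complex.I) - 1‖ ≤ 2 := by
  refine (norm_sub_le _ _).trans ?_
  rw [Complex.norm_exp_ofReal_mul_I, norm_one]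
  norm_num

/-- The characteristic functional of a Poisson process. -/
theorem IsPoissonProcess.characteristic [IsProbabilityMeasure P] [IsLocallyFiniteMeasure ν]
    (hZ : IsPoissonProcess Z ν P) (g : C_c(ℝ, ℝ)) :
    ∫ ω, Complex.exp ((∫ x, g x ∂(Z ω).toMeasure : ℝ) * Complex.I) ∂P
      = Complex.exp (∫ x, (Complex.exp (g x * Complex.I) - 1) ∂ν) := by
  have hK : IsCompact (tsupport g) := g.hasCompactSupport
  obtain ⟨c, hc⟩ := g.hasCompactSupport.exists_bound_of_continuous g.continuous
  have hc0 : 0 ≤ c := (norm_nonneg _).trans (hc 0)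
  have hgm : StronglyMeasurable g := g.continuous.stronglyMeasurable
  set s : ℕ → SimpleFunc ℝ ℝ := fun n => (hgm.approxBounded c n).restrict (tsupport g) with hs
  have hsx : ∀ n x, s n x = (tsupport g).indicator (hgm.approxBounded c n) x := fun n x =>
    SimpleFunc.restrict_apply _ hK.measurableSet x
  have hsc : ∀ n x, ‖s n x‖ ≤ c := by
    intro n x
    rw [hsx]
    by_cases hx : x ∈ tsupport g
    · rw [Set.indicator_of_mem hx]; exact hgm.norm_approxBounded_le hc0 n x
    · rw [Set.indicator_of_notMem hx]; simpa using hc0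
  have hs0 : ∀ n, ∀ x ∉ tsupport g, s n x = 0 := fun n x hx => by
    rw [hsx, Set.indicator_of_notMem hx]
  have hst : ∀ x, Tendsto (fun n => s n x) atTop (𝓝 (g x)) := by
    intro x
    by_cases hx : x ∈ tsupport g
    · simp_rw [hsx, Set.indicator_of_mem hx]
      exact hgm.tendsto_approxBounded_of_norm_le (hc x)
    · simp_rw [hs0 _ x hx, image_eq_zero_of_notMem_tsupport hx]
      exact tendsto_const_nhds
  have hL : Tendsto (fun n => ∫ ω, Complex.exp ((∫ x, s n x ∂(Z ω).toMeasure : ℝ) * Complex.I) ∂P)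
      atTop (𝓝 (∫ ω, Complex.exp ((∫ x, g x ∂(Z ω).toMeasure : ℝ) * Complex.I) ∂P)) := by
    refine tendsto_integral_of_dominated_convergence (fun _ => 1) ?_ (integrable_const _) ?_ ?_
    · intro n
      have hm : AEMeasurable (fun ω => ∫ x, s n x ∂(Z ω).toMeasure) P := by
        simp_rw [hs, integral_restrict_simpleFunc hK]
        refine Finset.aemeasurable_fun_sum _ fun y _ => ?_
        have := (hZ.hasLaw _ (SimpleFunc.measurableSet_preimage (s n) {y})).aemeasurable
        exact this.ennreal_toReal.const_mul y
      have hcc : Continuous fun r : ℝ => Complex.exp (r * Complex.I) := by fun_prop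
      exact (hcc.measurable.comp_aemeasurable hm).aestronglyMeasurable
    · exact fun n => Eventually.of_forall fun ω => (Complex.norm_exp_ofReal_mul_I _).le
    · refine Eventually.of_forall fun ω => ?_
      have := tendsto_integral_restrict_approx (μ := (Z ω).toMeasure) (h := id) hK
        continuous_id hsc hs0 hst
        (fun n => (s n).measurable.aestronglyMeasurable)
      have hcc : Continuous fun r : ℝ => Complex.exp (r * Complex.I) := by fun_prop
      exact (hcc.tendsto _).comp this
  have hR : Tendsto (fun n => Complex.exp (∫ x, (Complex.exp (s n x * Complex.I) - 1) ∂ν))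
      atTop (𝓝 (Complex.exp (∫ x, (Complex.exp (g x * Complex.I) - 1) ∂ν))) := by
    refine (Complex.continuous_exp.tendsto _).comp ?_
    have hcc : Continuous fun r : ℝ => Complex.exp (r * Complex.I) - 1 := by fun_prop
    refine tendsto_integral_restrict_approx hK hcc (c := 2)
      (fun n x => norm_exp_ofReal_mul_I_sub_one_le _) (fun n x hx => ?_) hst
      (fun n => (hcc.measurable.comp (s n).measurable).aestronglyMeasurable)
    rw [hs0 n x hx]; simp
  refine tendsto_nhds_unique hL (hR.congr fun n => ?_)
  rw [hs, hZ.characteristic_simpleFunc hK]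

end CharacteristicFunctional

/-! ### Words and their suffixes -/

/-- The words of length `n` over `Fin k`. -/
def words (k n : ℕ) : Finset (List (Fin k)) :=
  (Finset.univ : Finset (List.Vector (Fin k) n)).map
    ⟨List.Vector.toList, List.Vector.toList_injective⟩

theorem mem_words {k n : ℕ} {v : List (Fin k)} : v ∈ words k n ↔ v.length = n := by
  simp only [words, Finset.mem_map, Finset.mem_univ, true_and, Function.Embedding.coeFn_mk]
  exact ⟨fun ⟨a, ha⟩ => ha ▸ a.toList_length, fun h => ⟨⟨v, h⟩, rfl⟩⟩

theorem card_words (k n : ℕ) : (words k n).card = k ^ n := by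
  rw [words, Finset.card_map, Finset.card_univ, card_vector, Fintype.card_fin]

theorem sum_vector {k n : ℕ} {M : Type*} [AddCommMonoid M] (f : List (Fin k) → M) :
    ∑ v : List.Vector (Fin k) n, f v.toList = ∑ v ∈ words k n, f v := by
  rw [words, Finset.sum_map]
  rfl

@[to_additive]
theorem prod_words_add {k d m : ℕ} {M : Type*} [CommMonoid M] (f : List (Fin k) → M) :
    ∏ v ∈ words k (d + m), f v = ∏ u ∈ words k m, ∏ a ∈ words k d, f (a ++ u) := by
  rw [← Finset.prod_product' (f := fun u a => f (a ++ u))]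
  refine Finset.prod_nbij' (fun v => (v.drop d, v.take d)) (fun p => p.2 ++ p.1) ?_ ?_ ?_ ?_ ?_
  · intro v hv
    simp only [Finset.mem_product, mem_words] at hv ⊢
    simp [hv]
  · intro p hp
    simp only [Finset.mem_product, mem_words] at hp ⊢
    simp [hp.1, hp.2]
  · intro v _
    simp
  · rintro ⟨u, a⟩ hp
    simp only [Finset.mem_product, mem_words] at hp
    simp [← hp.2]
  · intro v _
    simp

/-- The finite set of suffixes of a word, that is, of ancestors of a vertex (itself included). -/
def ancestors {k : ℕ} (v : List (Fin k)) : Finset (List (Fin k)) := v.tails.toFinset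

theorem mem_ancestors {k : ℕ} {v w : List (Fin k)} : w ∈ ancestors v ↔ w <:+ v := by
  simp [ancestors]

theorem ancestors_nil {k : ℕ} : ancestors ([] : List (Fin k)) = {[]} := by
  ext; simp [mem_ancestors]

theorem ancestors_cons {k : ℕ} (i : Fin k) (v : List (Fin k)) :
    ancestors (i :: v) = insert (i :: v) (ancestors v) := by
  ext; simp [mem_ancestors, List.suffix_cons_iff]

theorem cons_notMem_ancestors {k : ℕ} (i : Fin k) (v : List (Fin k)) :
    i :: v ∉ ancestors v := fun h => by
  have := (mem_ancestors.1 h).length_le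
  simp at this

theorem length_le_of_mem_ancestors {k : ℕ} {v w : List (Fin k)} (h : w ∈ ancestors v) :
    w.length ≤ v.length := (mem_ancestors.1 h).length_le

theorem prod_ancestors {k : ℕ} {M : Type*} [CommMonoid M] (m : ℕ) (v : List (Fin k)) (f : ℕ → M) :
    ∏ w ∈ ancestors v with m < w.length, f w.length = ∏ l ∈ Finset.Ioc m v.length, f l := by
  refine Finset.prod_nbij' List.length (fun l => v.drop (v.length - l)) ?_ ?_ ?_ ?_ ?_
  · intro w hw
    rw [Finset.mem_filter] at hw
    exact Finset.mem_Ioc.2 ⟨hw.2, length_le_of_mem_ancestors hw.1⟩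
  · intro l hl
    rw [Finset.mem_Ioc] at hl
    refine Finset.mem_filter.2 ⟨mem_ancestors.2 (List.drop_suffix _ _), ?_⟩
    rw [List.length_drop]
    omega
  · intro w hw
    exact (List.suffix_iff_eq_drop.1 (mem_ancestors.1 (Finset.mem_filter.1 hw).1)).symm
  · intro l hl
    rw [Finset.mem_Ioc] at hl
    simp only [List.length_drop]
    omega
  · intros; rfl

theorem rescaled_nil {k : ℕ} (q : ℝ) (W : List (Fin k) → ℝ) : rescaled q W [] = W [] := by
  simp [rescaled, splitTime]

theorem rescaled_cons {k : ℕ} {q : ℝ} (hq : q ≠ 0) (W : List (Fin k) → ℝ) (i : Fin k)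
    (v : List (Fin k)) : rescaled q W (i :: v) = W (i :: v) + q * rescaled q W v := by
  have : q ^ (v.length + 1) ≠ 0 := pow_ne_zero _ hq
  simp only [rescaled, splitTime, List.length_cons]
  rw [mul_add, ← mul_assoc, mul_inv_cancel₀ this]
  ring

theorem rescaled_eq_sum {k : ℕ} {q : ℝ} (hq : q ≠ 0) (W : List (Fin k) → ℝ)
    (v : List (Fin k)) :
    rescaled q W v = ∑ w ∈ ancestors v, q ^ (v.length - w.length) * W w := by
  induction v with
  | nil => simp [rescaled_nil, ancestors_nil]
  | cons i v ih =>
    rw [rescaled_cons hq, ih, ancestors_cons, Finset.sum_insert (cons_notMem_ancestors i v),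
      Finset.mul_sum]
    congr 1
    · simp
    · refine Finset.sum_congr rfl fun w hw => ?_
      rw [List.length_cons, Nat.succ_sub (length_le_of_mem_ancestors hw), pow_succ]
      ring

theorem sum_pow_ancestors_le {k : ℕ} {q : ℝ} (hq : 0 < q) (hq1 : q < 1) (v : List (Fin k)) :
    ∑ w ∈ ancestors v, q ^ (v.length - w.length) ≤ 1 / (1 - q) := by
  have h1 : 0 < 1 - q := by linarith
  induction v with
  | nil =>
    rw [ancestors_nil, Finset.sum_singleton, le_div_iff₀ h1]
    simp [hq.le]
  | cons i v ih =>
    rw [ancestors_cons, Finset.sum_insert (cons_notMem_ancestors i v)]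
    have : ∑ w ∈ ancestors v, q ^ ((i :: v).length - w.length)
        = q * ∑ w ∈ ancestors v, q ^ (v.length - w.length) := by
      rw [Finset.mul_sum]
      refine Finset.sum_congr rfl fun w hw => ?_
      rw [List.length_cons, Nat.succ_sub (length_le_of_mem_ancestors hw), pow_succ, mul_comm]
    rw [this, Nat.sub_self, pow_zero]
    calc 1 + q * _ ≤ 1 + q * (1 / (1 - q)) := by gcongr
      _ = 1 / (1 - q) := by field_simp; ring

/-- The contribution to the rescaled position of `v` of the ancestors in generations after `m`. -/
noncomputable def truncated {k : ℕ} (q : ℝ) (W : List (Fin k) → ℝ) (m : ℕ) (v : List (Fin k)) : ℝ :=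
  ∑ w ∈ ancestors v with m < w.length, q ^ (v.length - w.length) * W w

theorem truncated_le {k : ℕ} {q : ℝ} (hq : 0 < q) {W : List (Fin k) → ℝ} (hW : ∀ v, 0 ≤ W v)
    (m : ℕ) (v : List (Fin k)) : truncated q W m v ≤ rescaled q W v := by
  rw [rescaled_eq_sum hq.ne']
  exact Finset.sum_le_sum_of_subset_of_nonneg (Finset.filter_subset _ _)
    fun w _ _ => mul_nonneg (pow_nonneg hq.le _) (hW w)

theorem truncated_nonneg {k : ℕ} {q : ℝ} (hq : 0 < q) {W : List (Fin k) → ℝ} (hW : ∀ v, 0 ≤ W v)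
    (m : ℕ) (v : List (Fin k)) : 0 ≤ truncated q W m v :=
  Finset.sum_nonneg fun w _ => mul_nonneg (pow_nonneg hq.le _) (hW w)

theorem truncated_cons {k : ℕ} (q : ℝ) (W : List (Fin k) → ℝ) {m : ℕ} (i : Fin k)
    {v : List (Fin k)} (hv : m ≤ v.length) :
    truncated q W m (i :: v) = W (i :: v) + q * truncated q W m v := by
  rw [truncated, truncated, ancestors_cons, Finset.filter_insert,
    if_pos (by rw [List.length_cons]; omega), Finset.sum_insert, Finset.mul_sum]
  · congr 1
    · simp
    · refine Finset.sum_congr rfl fun w hw => ?_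
      rw [List.length_cons, Nat.succ_sub
        (length_le_of_mem_ancestors (Finset.mem_filter.1 hw).1), pow_succ]
      ring
  · exact fun h => cons_notMem_ancestors i v (Finset.mem_filter.1 h).1

theorem rescaled_append {k : ℕ} {q : ℝ} (hq : q ≠ 0) (W : List (Fin k) → ℝ)
    (a u : List (Fin k)) :
    rescaled q W (a ++ u) = truncated q W u.length (a ++ u) + q ^ a.length * rescaled q W u := by
  induction a with
  | nil =>
    have : truncated q W u.length u = 0 := by
      rw [truncated, Finset.filter_false_of_mem, Finset.sum_empty]
      exact fun w hw => not_lt.2 (length_le_of_mem_ancestors hw)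
    simp [this]
  | cons i a ih =>
    rw [List.cons_append, rescaled_cons hq, ih, truncated_cons _ _ _ (by simp), List.length_cons]
    ring

/-- The descendants `a ++ u` of `u` with `1 ≤ |a| ≤ d`. -/
def descendants {k : ℕ} (d : ℕ) (u : List (Fin k)) : Finset (List (Fin k)) := by
  classical
  exact (Finset.Icc 1 d).biUnion fun j => (words k j).image fun a => a ++ u

theorem mem_descendants {k d : ℕ} {u w : List (Fin k)} : w ∈ descendants d u ↔
    u <:+ w ∧ u.length < w.length ∧ w.length ≤ d + u.length := by
  classical
  simp only [descendants, Finset.mem_biUnion, Finset.mem_Icc, Finset.mem_image, mem_words]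
  constructor
  · rintro ⟨j, hj, a, ha, rfl⟩
    refine ⟨List.suffix_append _ _, ?_⟩
    rw [List.length_append]
    omega
  · rintro ⟨⟨a, rfl⟩, h1, h2⟩
    rw [List.length_append] at h1 h2
    exact ⟨a.length, by omega, a, rfl, rfl⟩

theorem disjoint_descendants {k d : ℕ} {u u' : List (Fin k)} (h : u.length = u'.length)
    (hne : u ≠ u') : Disjoint (descendants d u) (descendants d u') := by
  refine Finset.disjoint_left.2 fun w hw hw' => hne ?_
  rw [mem_descendants] at hw hw'
  exact (List.suffix_of_suffix_length_le hw.1 hw'.1 h.le).eq_of_length h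

theorem truncated_congr {k d : ℕ} {q : ℝ} {W W' : List (Fin k) → ℝ} {a u : List (Fin k)}
    (ha : a.length ≤ d) (h : ∀ w ∈ descendants d u, W w = W' w) :
    truncated q W u.length (a ++ u) = truncated q W' u.length (a ++ u) := by
  refine Finset.sum_congr rfl fun w hw => ?_
  rw [Finset.mem_filter, mem_ancestors] at hw
  rw [h w (mem_descendants.2 ⟨List.suffix_of_suffix_length_le (List.suffix_append _ _) hw.1 hw.2.le,
    hw.2, ?_⟩)]
  have := hw.1.length_le
  rw [List.length_append] at this
  omega

/-! ### Exponential variables -/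

theorem measurable_exponentialPDF (r : ℝ) : Measurable (exponentialPDF r) :=
  (measurable_exponentialPDFReal r).ennreal_ofReal

theorem expMeasure_eq_withDensity (r : ℝ) :
    expMeasure r = volume.withDensity (exponentialPDF r) := rfl

theorem lintegral_exp_mul_expMeasure {c : ℝ} (hc : c < 1) :
    ∫⁻ x, ENNReal.ofReal (Real.exp (c * x)) ∂(expMeasure 1) = ENNReal.ofReal (1 / (1 - c)) := by
  have hc' : 0 < 1 - c := by linarith
  have e : ∀ x, exponentialPDF 1 x * ENNReal.ofReal (Real.exp (c * x))
      = ENNReal.ofReal (1 / (1 - c)) * exponentialPDF (1 - c) x := by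
    intro x
    rcases lt_or_ge x 0 with hx | hx
    · rw [exponentialPDF_of_neg hx, exponentialPDF_of_neg hx]; simp
    · rw [exponentialPDF_of_nonneg hx, exponentialPDF_of_nonneg hx,
        ← ENNReal.ofReal_mul (by positivity), ← ENNReal.ofReal_mul (by positivity)]
      congr 1
      rw [← mul_assoc, one_div_mul_cancel hc'.ne', one_mul, one_mul, ← Real.exp_add]
      ring_nf
  rw [expMeasure_eq_withDensity, lintegral_withDensity_eq_lintegral_mul _
    (measurable_exponentialPDF 1) (by fun_prop)]
  change ∫⁻ x, exponentialPDF 1 x * ENNReal.ofReal (Real.exp (c * x)) = _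
  simp_rw [e]
  rw [lintegral_const_mul _ (measurable_exponentialPDF _),
    lintegral_exponentialPDF_eq_one hc', mul_one]

theorem expMeasure_Ici_le (a : ℝ) : expMeasure 1 (Set.Ici a) ≤ ENNReal.ofReal (Real.exp (-a)) := by
  rw [expMeasure_eq_withDensity, withDensity_apply _ measurableSet_Ici]
  calc ∫⁻ x in Set.Ici a, exponentialPDF 1 x
      ≤ ∫⁻ x in Set.Ici a, ENNReal.ofReal (Real.exp (-x)) := by
        refine lintegral_mono fun x => ?_
        rw [exponentialPDF_eq]
        refine ENNReal.ofReal_le_ofReal ?_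
        split_ifs <;> simp [Real.exp_nonneg]
    _ = ENNReal.ofReal (Real.exp (-a)) := by
        rw [← ofReal_integral_eq_lintegral_ofReal, integral_Ici_eq_integral_Ioi,
          integral_exp_neg_Ioi]
        · exact (integrableOn_Ici_iff_integrableOn_Ioi).2 (integrableOn_exp_neg_Ioi a)
        · exact Eventually.of_forall fun x => Real.exp_nonneg _

theorem integral_expMeasure_shift (h : ℝ → ℂ) (b : ℝ) :
    ∫ x, h (x - b) ∂(expMeasure 1)
      = Real.exp (-b) * ∫ s in Set.Ici (-b), Real.exp (-s) * h s := by
  rw [expMeasure_eq_withDensity, integral_withDensity_eq_integral_toReal_smul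
    (measurable_exponentialPDF 1) (by simp [exponentialPDF])]
  change ∫ x, (exponentialPDF 1 x).toReal • h (x - b) = _
  rw [← integral_add_right_eq_self _ b, ← integral_indicator measurableSet_Ici,
    ← integral_const_mul]
  refine integral_congr_ae (Eventually.of_forall fun s => ?_)
  simp only [add_sub_cancel_right]
  rw [exponentialPDF_eq]
  by_cases hs : 0 ≤ s + b
  · rw [if_pos hs, Set.indicator_of_mem (show s ∈ Set.Ici (-b) by simp; linarith),
      ENNReal.toReal_ofReal (by positivity), one_mul, one_mul, neg_add_rev, Real.exp_add,
      Complex.real_smul]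
    push_cast
    ring
  · rw [if_neg hs, Set.indicator_of_notMem (show s ∉ Set.Ici (-b) by simp; linarith)]
    simp

/-- A family of independent standard exponential variables, realised as measurable nonnegative
functions. -/
structure IsExpFamily {ι Ω : Type*} [MeasurableSpace Ω] (W : ι → Ω → ℝ) (P : Measure Ω) : Prop where
  measurable : ∀ v, Measurable (W v)
  nonneg : ∀ v ω, 0 ≤ W v ω
  hasLaw : ∀ v, HasLaw (W v) (expMeasure 1) P
  indep : iIndepFun W P

namespace IsExpFamily

variable {ι Ω : Type*} [MeasurableSpace Ω] {W : ι → Ω → ℝ} {P : Measure Ω}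

theorem lintegral_exp_sum (h : IsExpFamily W P) (s : Finset ι) {c : ι → ℝ}
    (hc : ∀ w ∈ s, c w < 1) :
    ∫⁻ ω, ENNReal.ofReal (Real.exp (∑ w ∈ s, c w * W w ω)) ∂P
      = ENNReal.ofReal (∏ w ∈ s, 1 / (1 - c w)) := by
  have hm := h.measurable
  have e : ∀ ω, ENNReal.ofReal (Real.exp (∑ w ∈ s, c w * W w ω))
      = ∏ w ∈ s, ENNReal.ofReal (Real.exp (c w * W w ω)) := by
    intro ω
    rw [Real.exp_sum, ENNReal.ofReal_prod_of_nonneg fun _ _ => Real.exp_nonneg _]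
  simp_rw [e]
  have hi : iIndepFun (fun w ω => ENNReal.ofReal (Real.exp (c w * W w ω))) P :=
    h.indep.comp (fun w x => ENNReal.ofReal (Real.exp (c w * x))) fun w => by fun_prop
  rw [lintegral_prod_eq_prod_lintegral_of_indepFun s _ hi fun w => by
      have := hm w; fun_prop,
    ENNReal.ofReal_prod_of_nonneg fun w hw => by have := hc w hw; positivity [sub_pos.2 this]]
  refine Finset.prod_congr rfl fun w hw => ?_
  rw [← lintegral_exp_mul_expMeasure (hc w hw), ← (h.hasLaw w).lintegral_comp (by fun_prop)]

theorem integrable_exp_sum (h : IsExpFamily W P) (s : Finset ι) {c : ι → ℝ}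
    (hc : ∀ w ∈ s, c w < 1) : Integrable (fun ω => Real.exp (∑ w ∈ s, c w * W w ω)) P := by
  have hm := h.measurable
  refine ⟨by fun_prop, ?_⟩
  rw [hasFiniteIntegral_iff_ofReal (Eventually.of_forall fun _ => Real.exp_nonneg _),
    h.lintegral_exp_sum s hc]
  exact ENNReal.ofReal_lt_top

theorem integral_exp_sum (h : IsExpFamily W P) (s : Finset ι) {c : ι → ℝ}
    (hc : ∀ w ∈ s, c w < 1) :
    ∫ ω, Real.exp (∑ w ∈ s, c w * W w ω) ∂P = ∏ w ∈ s, 1 / (1 - c w) := by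
  rw [integral_eq_lintegral_of_nonneg_ae (Eventually.of_forall fun _ => Real.exp_nonneg _)
    (h.integrable_exp_sum s hc).aestronglyMeasurable, h.lintegral_exp_sum s hc,
    ENNReal.toReal_ofReal]
  exact Finset.prod_nonneg fun w hw => by have := hc w hw; exact (one_div_pos.2 (by linarith)).le

theorem integral_exp_sum_le (h : IsExpFamily W P) (s : Finset ι) {c : ι → ℝ} {c₀ B : ℝ}
    (hc : ∀ w ∈ s, c w ≤ c₀) (hc' : ∀ w ∈ s, 0 ≤ c w) (hc₀ : c₀ < 1) (hB : ∑ w ∈ s, c w ≤ B) :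
    ∫ ω, Real.exp (∑ w ∈ s, c w * W w ω) ∂P ≤ Real.exp (B / (1 - c₀)) := by
  have h0 : 0 < 1 - c₀ := by linarith
  rw [h.integral_exp_sum s fun w hw => (hc w hw).trans_lt hc₀]
  calc ∏ w ∈ s, 1 / (1 - c w) ≤ ∏ w ∈ s, Real.exp (c w / (1 - c₀)) := by
        refine Finset.prod_le_prod (fun w hw => ?_) fun w hw => ?_
        · have := hc w hw; exact (one_div_pos.2 (by linarith)).le
        · have h1 := hc w hw
          have h2 := hc' w hw
          have h3 : 0 < 1 - c w := by linarith
          have h4 := Real.add_one_le_exp (c w / (1 - c₀))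
          refine le_trans ?_ h4
          have h5 : c w / (1 - c w) ≤ c w / (1 - c₀) :=
            div_le_div_of_nonneg_left h2 h0 (by linarith)
          have h6 : 1 / (1 - c w) = c w / (1 - c w) + 1 := by field_simp; ring
          linarith
    _ = Real.exp ((∑ w ∈ s, c w) / (1 - c₀)) := by rw [← Real.exp_sum, Finset.sum_div]
    _ ≤ _ := by gcongr

theorem measureReal_sum_ge_le (h : IsExpFamily W P) [IsProbabilityMeasure P] (s : Finset ι)
    {c : ι → ℝ} {θ c₀ B : ℝ}
    (hθ : 0 ≤ θ) (hc : ∀ w ∈ s, θ * c w ≤ c₀) (hc' : ∀ w ∈ s, 0 ≤ c w) (hc₀ : c₀ < 1)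
    (hB : ∑ w ∈ s, c w ≤ B) (x : ℝ) :
    P.real {ω | x ≤ ∑ w ∈ s, c w * W w ω} ≤ Real.exp (θ * B / (1 - c₀)) * Real.exp (-θ * x) := by
  have e : ∀ ω, θ * ∑ w ∈ s, c w * W w ω = ∑ w ∈ s, (θ * c w) * W w ω := fun ω => by
    rw [Finset.mul_sum]; exact Finset.sum_congr rfl fun w _ => by ring
  refine (measure_ge_le_exp_mul_mgf x hθ ?_).trans ?_
  · simp_rw [e]
    exact h.integrable_exp_sum s fun w hw => (hc w hw).trans_lt hc₀
  · rw [mul_comm, mgf]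
    simp_rw [e]
    refine mul_le_mul_of_nonneg_right ?_ (Real.exp_nonneg _)
    refine h.integral_exp_sum_le s hc (fun w hw => mul_nonneg hθ (hc' w hw)) hc₀ ?_
    rw [← Finset.mul_sum]
    gcongr

end IsExpFamily

/-- The law of a sum of a standard exponential variable and an independent variable. -/
theorem integral_add_of_indepFun {Ω E : Type*} [MeasurableSpace Ω] {P : Measure Ω}
    [NormedAddCommGroup E] [NormedSpace ℝ E] [IsProbabilityMeasure P] {X R : Ω → ℝ}
    (hX : HasLaw X (expMeasure 1) P) (hR : Measurable R) (hXR : IndepFun R X P)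
    {h : ℝ → E} (hh : StronglyMeasurable h) {c : ℝ} (hc : ∀ x, ‖h x‖ ≤ c) :
    ∫ ω, h (X ω + R ω) ∂P = ∫ ω, (∫ x, h (x + R ω) ∂(expMeasure 1)) ∂P := by
  have : IsProbabilityMeasure (expMeasure 1) := isProbabilityMeasure_expMeasure one_pos
  have : IsProbabilityMeasure (P.map R) := Measure.isProbabilityMeasure_map hR.aemeasurable
  have h1 := (indepFun_iff_map_prod_eq_prod_map_map hR.aemeasurable hX.aemeasurable).1 hXR
  have hsm : StronglyMeasurable fun p : ℝ × ℝ => h (p.2 + p.1) :=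
    hh.comp_measurable (by fun_prop)
  calc ∫ ω, h (X ω + R ω) ∂P = ∫ p, h (p.2 + p.1) ∂(P.map fun ω => (R ω, X ω)) := by
        rw [integral_map (hR.aemeasurable.prodMk hX.aemeasurable) hsm.aestronglyMeasurable]
    _ = ∫ r, ∫ x, h (x + r) ∂(expMeasure 1) ∂(P.map R) := by
        rw [h1, hX.map_eq, integral_prod]
        exact Integrable.of_bound hsm.aestronglyMeasurable c (Eventually.of_forall fun p => hc _)
    _ = _ := by
        rw [integral_map hR.aemeasurable]
        exact (StronglyMeasurable.integral_prod_right (f := fun r x => h (x + r))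
          hsm).aestronglyMeasurable

theorem measureReal_add_ge_le {Ω : Type*} [MeasurableSpace Ω] {P : Measure Ω}
    [IsProbabilityMeasure P] {X R : Ω → ℝ}
    (hX : HasLaw X (expMeasure 1) P) (hR : Measurable R) (hXR : IndepFun R X P)
    (hi : Integrable (fun ω => Real.exp (R ω)) P) (x : ℝ) :
    P.real {ω | x ≤ X ω + R ω} ≤ (∫ ω, Real.exp (R ω) ∂P) * Real.exp (-x) := by
  have : IsProbabilityMeasure (expMeasure 1) := isProbabilityMeasure_expMeasure one_pos
  have h1 := integral_add_of_indepFun hX hR hXR (h := (Set.Ici x).indicator fun _ => (1 : ℝ))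
    (stronglyMeasurable_const.indicator measurableSet_Ici) (c := 1) (fun y => by
      by_cases hy : y ∈ Set.Ici x <;> simp [hy])
  have hn : NullMeasurableSet {ω | x ≤ X ω + R ω} P :=
    nullMeasurableSet_le aemeasurable_const (hX.aemeasurable.add hR.aemeasurable)
  have e1 : ∫ ω, (Set.Ici x).indicator (fun _ => (1 : ℝ)) (X ω + R ω) ∂P
      = P.real {ω | x ≤ X ω + R ω} := by
    have : (fun ω => (Set.Ici x).indicator (fun _ => (1 : ℝ)) (X ω + R ω))
        = {ω | x ≤ X ω + R ω}.indicator fun _ => (1 : ℝ) := rfl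
    rw [this, integral_indicator₀ hn]
    simp
  rw [← e1, h1, ← integral_mul_const]
  refine integral_mono_of_nonneg (Eventually.of_forall fun ω => integral_nonneg fun y =>
    Set.indicator_nonneg (fun _ _ => zero_le_one) _) (hi.mul_const _)
    (Eventually.of_forall fun ω => ?_)
  have e2 : (fun y => (Set.Ici x).indicator (fun _ => (1 : ℝ)) (y + R ω))
      = (Set.Ici (x - R ω)).indicator 1 := by
    funext y
    simp only [Set.indicator, Set.mem_Ici, Pi.one_apply, sub_le_iff_le_add]
  simp only
  rw [e2, integral_indicator_one measurableSet_Ici, ← Real.exp_add, Measure.real]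
  refine ENNReal.toReal_le_of_le_ofReal (Real.exp_nonneg _) ((expMeasure_Ici_le _).trans_eq ?_)
  congr 2; ring

/-- The first moment estimate. -/
theorem norm_integral_add_sub_le {Ω : Type*} [MeasurableSpace Ω] {P : Measure Ω}
    [IsProbabilityMeasure P] {X R : Ω → ℝ}
    (hX : HasLaw X (expMeasure 1) P) (hR : Measurable R) (hXR : IndepFun R X P)
    {δ : ℝ} (hδ : 0 < δ) (hi : Integrable (fun ω => Real.exp (R ω)) P)
    (hi' : Integrable (fun ω => Real.exp ((1 + δ) * R ω)) P)
    {h : ℝ → ℂ} (hh : Continuous h) {c A : ℝ} (hc : ∀ x, ‖h x‖ ≤ c) (hA : ∀ x, A < |x| → h x = 0)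
    (t : ℝ) :
    ‖Real.exp t * ∫ ω, h (X ω + R ω - t) ∂P
        - (∫ ω, Real.exp (R ω) ∂P : ℝ) * ∫ s, Real.exp (-s) * h s‖
      ≤ (∫ s, ‖Real.exp (-s) * h s‖) * (Real.exp (-(δ * (t - A)))
        * ∫ ω, Real.exp ((1 + δ) * R ω) ∂P) := by
  set G : ℝ → ℂ := fun s => Real.exp (-s) * h s with hG
  have hGi : Integrable G := by
    refine Continuous.integrable_of_hasCompactSupport (by fun_prop) ?_
    refine HasCompactSupport.intro (isCompact_Icc (a := -A) (b := A)) fun x hx => ?_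
    have : h x = 0 := hA x (by by_contra! h'; exact hx (abs_le.1 h'))
    simp [hG, this]
  have h1 := integral_add_of_indepFun hX hR hXR (h := fun y => h (y - t))
    (hh.comp (by fun_prop)).stronglyMeasurable (fun x => hc _)
  have e1 : ∀ ω, ∫ x, h (x + R ω - t) ∂(expMeasure 1)
      = Real.exp (-t) * (Real.exp (R ω) * ∫ s in Set.Ici (R ω - t), G s) := by
    intro ω
    have := integral_expMeasure_shift h (t - R ω)
    simp_rw [show ∀ x, x + R ω - t = x - (t - R ω) from fun x => by ring]
    rw [this, neg_sub, ← mul_assoc, ← Complex.ofReal_mul, ← Real.exp_add, sub_eq_add_neg,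
      add_comm (R ω)]
  simp only [e1] at h1
  have hint : ∀ r, ‖∫ s in Set.Ici (r - t), G s‖ ≤ ∫ s, ‖G s‖ := fun r =>
    (norm_integral_le_integral_norm _).trans (setIntegral_le_integral hGi.norm
      (Eventually.of_forall fun _ => norm_nonneg _))
  have hsm : StronglyMeasurable fun r : ℝ => ∫ s in Set.Ici (r - t), G s := by
    have : StronglyMeasurable fun p : ℝ × ℝ => (Set.Ici (p.1 - t)).indicator G p.2 := by
      have hset : MeasurableSet {p : ℝ × ℝ | p.1 - t ≤ p.2} :=
        measurableSet_le (by fun_prop) (by fun_prop)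
      have hGs : StronglyMeasurable fun p : ℝ × ℝ => G p.2 :=
        (show Continuous fun p : ℝ × ℝ => G p.2 by fun_prop).stronglyMeasurable
      exact hGs.indicator hset
    simp_rw [← integral_indicator measurableSet_Ici]
    exact this.integral_prod_right
  have hint2 : Integrable (fun ω => (Real.exp (R ω) : ℂ) * ∫ s in Set.Ici (R ω - t), G s) P := by
    refine (hi.mul_const (∫ s, ‖G s‖)).mono' ?_ (Eventually.of_forall fun ω => ?_)
    · exact hi.ofReal.aestronglyMeasurable.mul
        (hsm.comp_measurable hR).aestronglyMeasurable
    · rw [norm_mul, Complex.norm_real, Real.norm_of_nonneg (Real.exp_nonneg _)]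
      exact mul_le_mul_of_nonneg_left (hint _) (Real.exp_nonneg _)
  have hti : Integrable (fun ω => (Real.exp (R ω) : ℂ) * ∫ s, G s) P := hi.ofReal.mul_const _
  have e2 : Real.exp t * ∫ ω, h (X ω + R ω - t) ∂P
        - (∫ ω, Real.exp (R ω) ∂P : ℝ) * ∫ s, G s
      = ∫ ω, ((Real.exp (R ω) : ℂ) * (∫ s in Set.Ici (R ω - t), G s)
        - (Real.exp (R ω) : ℂ) * ∫ s, G s) ∂P := by
    rw [integral_sub hint2 hti, h1, integral_const_mul, integral_mul_const, ← mul_assoc,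
      ← Complex.ofReal_mul, ← Real.exp_add, add_neg_cancel, Real.exp_zero, Complex.ofReal_one,
      one_mul]
    congr 2
    exact integral_ofReal.symm
  rw [e2, ← integral_const_mul, ← integral_const_mul]
  refine norm_integral_le_of_norm_le ((hi'.const_mul _).const_mul _)
    (Eventually.of_forall fun ω => ?_)
  have hB : 0 ≤ ∫ s, ‖G s‖ := integral_nonneg fun _ => norm_nonneg _
  by_cases hr : R ω ≤ t - A
  · have : ∫ s in Set.Ici (R ω - t), G s = ∫ s, G s := by
      refine setIntegral_eq_integral_of_forall_compl_eq_zero fun s hs => ?_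
      have hs' : s < R ω - t := not_le.1 hs
      have : h s = 0 := hA s (by
        have := neg_abs_le s
        linarith)
      simp [hG, this]
    rw [this, sub_self, norm_zero]
    positivity
  · rw [← mul_sub, norm_mul, Complex.norm_real, Real.norm_of_nonneg (Real.exp_nonneg _)]
    have h2 : ‖(∫ s in Set.Ici (R ω - t), G s) - ∫ s, G s‖ ≤ ∫ s, ‖G s‖ := by
      rw [norm_sub_rev, ← setIntegral_univ (f := G), ← setIntegral_univ (f := fun s => ‖G s‖)]
      rw [← setIntegral_sdiff measurableSet_Ici hGi.integrableOn (Set.subset_univ _)]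
      refine (norm_integral_le_integral_norm _).trans ?_
      rw [setIntegral_univ]
      exact setIntegral_le_integral hGi.norm (Eventually.of_forall fun _ => norm_nonneg _)
    rw [mul_comm]
    refine mul_le_mul h2 ?_ (Real.exp_nonneg _) hB
    rw [← Real.exp_add]
    refine Real.exp_le_exp.2 ?_
    have : 0 ≤ δ * (R ω - (t - A)) := mul_nonneg hδ.le (by linarith)
    nlinarith

/-! ### Products of numbers in the unit disc -/

theorem norm_prod_le_one {ι : Type*} (s : Finset ι) {a : ι → ℂ} (ha : ∀ i ∈ s, ‖a i‖ ≤ 1) :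
    ‖∏ i ∈ s, a i‖ ≤ 1 := by
  rw [norm_prod]
  exact Finset.prod_le_one (fun i _ => norm_nonneg _) ha

theorem norm_prod_sub_prod_le {ι : Type*} (s : Finset ι) {a b : ι → ℂ}
    (ha : ∀ i ∈ s, ‖a i‖ ≤ 1) (hb : ∀ i ∈ s, ‖b i‖ ≤ 1) :
    ‖∏ i ∈ s, a i - ∏ i ∈ s, b i‖ ≤ ∑ i ∈ s, ‖a i - b i‖ := by
  classical
  induction s using Finset.induction_on with
  | empty => simp
  | insert i s hi ih =>
    rw [Finset.forall_mem_insert] at ha hb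
    rw [Finset.prod_insert hi, Finset.prod_insert hi, Finset.sum_insert hi]
    have e : a i * ∏ j ∈ s, a j - b i * ∏ j ∈ s, b j
        = (a i - b i) * ∏ j ∈ s, a j + b i * (∏ j ∈ s, a j - ∏ j ∈ s, b j) := by ring
    rw [e]
    refine (norm_add_le _ _).trans ?_
    rw [norm_mul, norm_mul]
    refine add_le_add ?_ ?_
    · exact mul_le_of_le_one_right (norm_nonneg _) (norm_prod_le_one s ha.2)
    · exact (mul_le_of_le_one_left (norm_nonneg _) hb.1).trans (ih ha.2 hb.2)

theorem norm_prod_one_add_sub_le {ι : Type*} [DecidableEq ι] (s : Finset ι) {z : ι → ℂ}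
    (hz : ∀ i ∈ s, ‖1 + z i‖ ≤ 1) :
    ‖∏ i ∈ s, (1 + z i) - 1 - ∑ i ∈ s, z i‖ ≤ ∑ i ∈ s, ∑ j ∈ s.erase i, ‖z i‖ * ‖z j‖ := by
  induction s using Finset.induction_on with
  | empty => simp
  | insert i s hi ih =>
    rw [Finset.forall_mem_insert] at hz
    rw [Finset.prod_insert hi, Finset.sum_insert hi, Finset.sum_insert hi,
      Finset.erase_insert hi]
    have e : (1 + z i) * ∏ j ∈ s, (1 + z j) - 1 - (z i + ∑ j ∈ s, z j)
        = z i * (∏ j ∈ s, (1 + z j) - 1) + (∏ j ∈ s, (1 + z j) - 1 - ∑ j ∈ s, z j) := by ring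
    rw [e]
    refine (norm_add_le _ _).trans (add_le_add ?_ ((ih hz.2).trans ?_))
    · rw [norm_mul, ← Finset.mul_sum]
      refine mul_le_mul_of_nonneg_left ?_ (norm_nonneg _)
      have := norm_prod_sub_prod_le s (a := fun j => 1 + z j) (b := fun _ => 1) hz.2 (by simp)
      simpa using this
    · refine Finset.sum_le_sum fun j _ => Finset.sum_le_sum_of_subset_of_nonneg
        (Finset.erase_subset_erase _ (Finset.subset_insert _ _)) fun _ _ _ => by positivity

/-- Independent products over disjoint groups of independent variables. -/
theorem integral_prod_of_dependsOn {ι U Ω : Type*} [MeasurableSpace Ω] {P : Measure Ω}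
    {W : ι → Ω → ℝ} (hW : ∀ i, Measurable (W i)) (hindep : iIndepFun W P)
    (S : U → Finset ι) (t : Finset U)
    (hS : ∀ u ∈ t, ∀ u' ∈ t, u ≠ u' → Disjoint (S u) (S u'))
    (F : U → (ι → ℝ) → ℂ) (hF : ∀ u, Measurable (F u))
    (hdep : ∀ u ∈ t, ∀ x y : ι → ℝ, (∀ i ∈ S u, x i = y i) → F u x = F u y) :
    ∫ ω, ∏ u ∈ t, F u (fun i => W i ω) ∂P = ∏ u ∈ t, ∫ ω, F u (fun i => W i ω) ∂P := by
  classical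
  induction t using Finset.induction_on with
  | empty =>
    have := hindep.isProbabilityMeasure
    simp
  | insert u t hu ih =>
    have ih' := ih (fun u₁ h₁ u₂ h₂ => hS u₁ (Finset.mem_insert_of_mem h₁) u₂
      (Finset.mem_insert_of_mem h₂)) (fun u₁ h₁ => hdep u₁ (Finset.mem_insert_of_mem h₁))
    simp_rw [Finset.prod_insert hu]
    rw [← ih']
    set S' : Finset ι := t.biUnion S with hS'
    have hdisj : Disjoint (S u) S' := by
      rw [hS', Finset.disjoint_biUnion_right]
      exact fun u' hu' => hS u (Finset.mem_insert_self _ _) u' (Finset.mem_insert_of_mem hu')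
        (fun h => hu (h ▸ hu'))
    have hI := hindep.indepFun_finset (S u) S' hdisj hW
    let ext : ∀ T : Finset ι, (T → ℝ) → ι → ℝ := fun T x i => if h : i ∈ T then x ⟨i, h⟩ else 0
    have hext : ∀ T, Measurable (ext T) := by
      refine fun T => measurable_pi_iff.2 fun i => ?_
      by_cases h : i ∈ T
      · simp only [ext, dif_pos h]; exact measurable_pi_apply _
      · simp only [ext, dif_neg h]; exact measurable_const
    have e1 : ∀ ω, F u (fun i => W i ω) = F u (ext (S u) fun i => W i ω) := fun ω =>
      hdep u (Finset.mem_insert_self _ _) _ _ fun i hi => by simp [ext, hi]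
    have e2 : ∀ ω, ∏ u' ∈ t, F u' (fun i => W i ω)
        = ∏ u' ∈ t, F u' (ext S' fun i => W i ω) := fun ω =>
      Finset.prod_congr rfl fun u' hu' => hdep u' (Finset.mem_insert_of_mem hu') _ _ fun i hi => by
        have : i ∈ S' := Finset.mem_biUnion.2 ⟨u', hu', hi⟩
        simp [ext, this]
    have hT : ∀ T : Finset ι, Measurable fun ω (i : T) => W i ω := fun T =>
      measurable_pi_iff.2 fun i => hW i
    simp_rw [e1, e2]
    exact hI.integral_fun_comp_mul_comp (hT _).aemeasurable (hT _).aemeasurable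
      ((hF u).comp (hext _)).aestronglyMeasurable
      (Finset.measurable_fun_prod t fun u' _ => (hF u').comp (hext _)).aestronglyMeasurable

/-- Poisson approximation for a null array of independent groups. -/
theorem norm_integral_prod_sub_exp_le {U B Ω : Type*} [DecidableEq B] [MeasurableSpace Ω]
    {P : Measure Ω}
    [IsProbabilityMeasure P] (s : Finset U) (t : Finset B) {z : U → B → Ω → ℂ} {p r : ℝ}
    (hr0 : 0 ≤ r)
    (hm : ∀ u b, Measurable (z u b)) (hz : ∀ u b ω, ‖1 + z u b ω‖ ≤ 1)
    (hprod : ∫ ω, ∏ u ∈ s, ∏ b ∈ t, (1 + z u b ω) ∂P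
      = ∏ u ∈ s, ∫ ω, ∏ b ∈ t, (1 + z u b ω) ∂P)
    (hp : ∀ u ∈ s, ∀ b ∈ t, ‖∫ ω, z u b ω ∂P‖ ≤ p) (hp1 : t.card * p ≤ 1)
    (hr : ∀ u ∈ s, ∀ b ∈ t, ∀ b' ∈ t, b ≠ b' → ∫ ω, ‖z u b ω‖ * ‖z u b' ω‖ ∂P ≤ r) :
    ‖∫ ω, ∏ u ∈ s, ∏ b ∈ t, (1 + z u b ω) ∂P - Complex.exp (∑ u ∈ s, ∑ b ∈ t, ∫ ω, z u b ω ∂P)‖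
      ≤ s.card * (t.card * (t.card * r) + (t.card * p) ^ 2) := by
  have hz2 : ∀ u b ω, ‖z u b ω‖ ≤ 2 := fun u b ω => by
    have h1 := norm_sub_le (1 + z u b ω) 1
    rw [add_sub_cancel_left, norm_one] at h1
    linarith [hz u b ω]
  have hzi : ∀ u b, Integrable (z u b) P := fun u b =>
    Integrable.of_bound (hm u b).aestronglyMeasurable 2 (Eventually.of_forall (hz2 u b))
  have hzz : ∀ u b b', Integrable (fun ω => ‖z u b ω‖ * ‖z u b' ω‖) P := fun u b b' =>
    Integrable.of_bound ((hm u b).norm.mul (hm u b').norm).aestronglyMeasurable 4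
      (Eventually.of_forall fun ω => by
        rw [norm_mul, norm_norm, norm_norm]
        nlinarith [hz2 u b ω, hz2 u b' ω, norm_nonneg (z u b ω), norm_nonneg (z u b' ω)])
  have hpi : ∀ u, Integrable (fun ω => ∏ b ∈ t, (1 + z u b ω)) P := fun u =>
    Integrable.of_bound (Finset.measurable_fun_prod t fun b _ =>
      (hm u b).const_add 1).aestronglyMeasurable 1
      (Eventually.of_forall fun ω => norm_prod_le_one t fun b _ => hz u b ω)
  set a : U → ℂ := fun u => ∑ b ∈ t, ∫ ω, z u b ω ∂P with ha
  have hnp : ∀ u, ‖∫ ω, ∏ b ∈ t, (1 + z u b ω) ∂P‖ ≤ 1 := fun u => by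
    refine (norm_integral_le_of_norm_le_const (C := 1) (Eventually.of_forall fun ω =>
      norm_prod_le_one t fun b _ => hz u b ω)).trans ?_
    simp
  have hre : ∀ u, (a u).re ≤ 0 := fun u => by
    rw [ha, Complex.re_sum]
    refine Finset.sum_nonpos fun b _ => ?_
    have : (∫ ω, z u b ω ∂P).re = ∫ ω, (z u b ω).re ∂P := (integral_re (hzi u b)).symm
    rw [this]
    refine integral_nonpos fun ω => ?_
    have h1 := (Complex.re_le_norm (1 + z u b ω)).trans (hz u b ω)
    simp only [Complex.add_re, Complex.one_re] at h1
    simp only [Pi.zero_apply]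
    linarith
  have han : ∀ u ∈ s, ‖a u‖ ≤ t.card * p := fun u hu => by
    refine (norm_sum_le _ _).trans ((Finset.sum_le_sum fun b hb => hp u hu b hb).trans ?_)
    simp
  rw [hprod, Complex.exp_sum]
  refine (norm_prod_sub_prod_le s (fun u _ => hnp u) (fun u _ => ?_)).trans ?_
  · rw [Complex.norm_exp]
    exact Real.exp_le_one_iff.2 (hre u)
  rw [← nsmul_eq_mul]
  refine Finset.sum_le_card_nsmul _ _ _ fun u hu => ?_
  have h1 : ‖(∫ ω, ∏ b ∈ t, (1 + z u b ω) ∂P) - 1 - a u‖ ≤ t.card * (t.card * r) := by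
    have e : (∫ ω, ∏ b ∈ t, (1 + z u b ω) ∂P) - 1 - a u
        = ∫ ω, (∏ b ∈ t, (1 + z u b ω) - 1 - ∑ b ∈ t, z u b ω) ∂P := by
      have hpi' : Integrable (fun ω => ∏ b ∈ t, (1 + z u b ω) - 1) P :=
        (hpi u).sub (integrable_const _)
      rw [integral_sub hpi' (integrable_finsetSum _ fun b _ => hzi u b),
        integral_sub (hpi u) (integrable_const _), integral_finsetSum _ fun b _ =>
        hzi u b]
      simp [ha]
    rw [e]
    refine (norm_integral_le_of_norm_le (integrable_finsetSum _ fun b _ =>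
      integrable_finsetSum _ fun b' _ => hzz u b b') (Eventually.of_forall fun ω =>
      norm_prod_one_add_sub_le t fun b _ => hz u b ω)).trans ?_
    rw [integral_finsetSum _ fun b _ => integrable_finsetSum _ fun b' _ => hzz u b b',
      ← nsmul_eq_mul]
    refine Finset.sum_le_card_nsmul _ _ _ fun b hb => ?_
    rw [integral_finsetSum _ fun b' _ => hzz u b b']
    refine (Finset.sum_le_card_nsmul _ _ r fun b' hb' => ?_).trans ?_
    · exact hr u hu b hb b' (Finset.mem_of_mem_erase hb') (Finset.ne_of_mem_erase hb').symm
    · rw [nsmul_eq_mul]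
      gcongr
      exact Finset.erase_subset _ _
  have h2 : ‖Complex.exp (a u) - 1 - a u‖ ≤ (t.card * p) ^ 2 := by
    refine (Complex.norm_exp_sub_one_sub_id_le ((han u hu).trans hp1)).trans ?_
    gcongr
    exact han u hu
  have e : (∫ ω, ∏ b ∈ t, (1 + z u b ω) ∂P) - Complex.exp (a u)
      = ((∫ ω, ∏ b ∈ t, (1 + z u b ω) ∂P) - 1 - a u) - (Complex.exp (a u) - 1 - a u) := by ring
  change ‖(∫ ω, ∏ b ∈ t, (1 + z u b ω) ∂P) - Complex.exp (a u)‖ ≤ _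
  rw [e]
  exact (norm_sub_le _ _).trans (add_le_add h1 h2)

/-! ### Moment estimates on the tree -/

namespace IsExpFamily

variable {k : ℕ} {Ω : Type*} [MeasurableSpace Ω] {P : Measure Ω} {W : List (Fin k) → Ω → ℝ}
  {q : ℝ}

theorem measurable_truncated (h : IsExpFamily W P) (m : ℕ) (v : List (Fin k)) :
    Measurable fun ω => truncated q (fun w => W w ω) m v :=
  Finset.measurable_fun_sum _ fun w _ => (h.measurable w).const_mul _

theorem measurable_rescaled (h : IsExpFamily W P) (hq : 0 < q) (v : List (Fin k)) :
    Measurable fun ω => rescaled q (fun w => W w ω) v := by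
  simp_rw [rescaled_eq_sum hq.ne']
  exact Finset.measurable_fun_sum _ fun w _ => (h.measurable w).const_mul _

theorem measureReal_rescaled_ge_le (h : IsExpFamily W P) [IsProbabilityMeasure P] (hq : 0 < q)
    (hq1 : q < 1) (v : List (Fin k)) (x : ℝ) :
    P.real {ω | x ≤ rescaled q (fun w => W w ω) v}
      ≤ Real.exp (1 / (1 - q)) * Real.exp (-x / 2) := by
  simp_rw [rescaled_eq_sum hq.ne']
  refine (h.measureReal_sum_ge_le _ (θ := 1 / 2) (c₀ := 1 / 2) (by norm_num) (fun w _ => ?_)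
    (fun w _ => pow_nonneg hq.le _) (by norm_num) (sum_pow_ancestors_le hq hq1 v) x).trans_eq ?_
  · have := pow_le_one₀ (n := v.length - w.length) hq.le hq1.le
    linarith
  · congr 2 <;> ring

/-- Two different vertices are both high with small probability. -/
theorem measureReal_pair_le (h : IsExpFamily W P) [IsProbabilityMeasure P] (hq : 0 < q)
    (hq1 : q < 1) {θ : ℝ} (hθ : 0 ≤ θ) (hθq : θ * (1 + q) < 1) {v v' : List (Fin k)}
    (hv : v ≠ v') (m : ℕ) (x x' : ℝ) :
    P.real {ω | x ≤ truncated q (fun w => W w ω) m v ∧ x' ≤ truncated q (fun w => W w ω) m v'}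
      ≤ Real.exp (θ * (2 / (1 - q)) / (1 - θ * (1 + q))) * Real.exp (-θ * (x + x')) := by
  classical
  let c : List (Fin k) → List (Fin k) → ℝ := fun v w =>
    if w ∈ ancestors v then q ^ (v.length - w.length) else 0
  have hc0 : ∀ v w, 0 ≤ c v w := fun v w => by
    simp only [c]
    split_ifs
    exacts [pow_nonneg hq.le _, le_rfl]
  have hc1 : ∀ v w, c v w ≤ 1 := fun v w => by
    simp only [c]
    split_ifs
    exacts [pow_le_one₀ hq.le hq1.le, zero_le_one]
  have hcq : ∀ v w, v ≠ w → c v w ≤ q := fun v w hvw => by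
    simp only [c]
    split_ifs with hw
    · refine pow_le_of_le_one hq.le hq1.le fun h0 => hvw ?_
      exact ((mem_ancestors.1 hw).eq_of_length (le_antisymm (length_le_of_mem_ancestors hw)
        (Nat.sub_eq_zero_iff_le.1 h0))).symm
    · exact hq.le
  set s := ancestors v ∪ ancestors v' with hs
  have hsum : ∀ u, ancestors u ⊆ s → ∀ f : List (Fin k) → ℝ,
      ∑ w ∈ s, c u w * f w = ∑ w ∈ ancestors u, q ^ (u.length - w.length) * f w := by
    intro u hu f
    rw [← Finset.sum_subset hu fun w _ hw => by simp [c, hw]]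
    exact Finset.sum_congr rfl fun w hw => by simp [c, hw]
  have h1 := hsum v Finset.subset_union_left
  have h2 := hsum v' Finset.subset_union_right
  have hB : ∑ w ∈ s, (c v w + c v' w) ≤ 2 / (1 - q) := by
    have e1 := h1 fun _ => 1
    have e2 := h2 fun _ => 1
    simp only [mul_one] at e1 e2
    rw [Finset.sum_add_distrib, e1, e2]
    have := sum_pow_ancestors_le hq hq1 v
    have := sum_pow_ancestors_le hq hq1 v'
    have : 2 / (1 - q) = 1 / (1 - q) + 1 / (1 - q) := by ring
    linarith
  refine (measureReal_mono (s₂ := {ω | x + x' ≤ ∑ w ∈ s, (c v w + c v' w) * W w ω}) ?_).trans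
    (h.measureReal_sum_ge_le s hθ (fun w _ => ?_) (fun w _ => add_nonneg (hc0 v w) (hc0 v' w))
      hθq hB _)
  · rintro ω ⟨hω, hω'⟩
    have e1 := h1 fun w => W w ω
    have e2 := h2 fun w => W w ω
    rw [← rescaled_eq_sum hq.ne'] at e1 e2
    simp only [Set.mem_ofPred_eq, add_mul, Finset.sum_add_distrib]
    rw [e1, e2]
    exact add_le_add (hω.trans (truncated_le hq (fun w => h.nonneg w ω) m v))
      (hω'.trans (truncated_le hq (fun w => h.nonneg w ω) m v'))
  · refine mul_le_mul_of_nonneg_left ?_ hθ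
    by_cases hw : v = w
    · have := hcq v' w (fun h' => hv (hw.trans h'.symm))
      linarith [hc1 v w]
    · linarith [hcq v w hw, hc1 v' w]

/-- The exponential moments of the contribution of the strict ancestors. -/
theorem integral_exp_tail (h : IsExpFamily W P) (hq : 0 < q) (hq1 : q < 1) {a : ℝ}
    (ha : 0 ≤ a) (haq : a * q < 1) (m : ℕ) (v : List (Fin k)) :
    Integrable (fun ω => Real.exp (a * (q * truncated q (fun w => W w ω) m v))) P ∧
    ∫ ω, Real.exp (a * (q * truncated q (fun w => W w ω) m v)) ∂P
      = ∏ l ∈ Finset.Ioc m v.length, 1 / (1 - a * q ^ (v.length + 1 - l)) ∧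
    ∫ ω, Real.exp (a * (q * truncated q (fun w => W w ω) m v)) ∂P
      ≤ Real.exp (a * (1 / (1 - q)) / (1 - a * q)) := by
  have e : ∀ ω, a * (q * truncated q (fun w => W w ω) m v)
      = ∑ w ∈ ancestors v with m < w.length, (a * q ^ (v.length + 1 - w.length)) * W w ω := by
    intro ω
    rw [truncated, Finset.mul_sum, Finset.mul_sum]
    refine Finset.sum_congr rfl fun w hw => ?_
    rw [Nat.succ_sub (length_le_of_mem_ancestors (Finset.mem_filter.1 hw).1), pow_succ]
    ring
  have hc : ∀ w ∈ {w ∈ ancestors v | m < w.length}, a * q ^ (v.length + 1 - w.length) ≤ a * q := by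
    intro w hw
    refine mul_le_mul_of_nonneg_left (pow_le_of_le_one hq.le hq1.le ?_) ha
    have := length_le_of_mem_ancestors (Finset.mem_filter.1 hw).1
    omega
  have hc0 : ∀ w ∈ {w ∈ ancestors v | m < w.length}, 0 ≤ a * q ^ (v.length + 1 - w.length) :=
    fun w _ => by positivity
  simp_rw [e]
  refine ⟨h.integrable_exp_sum _ fun w hw => (hc w hw).trans_lt haq, ?_, ?_⟩
  · rw [h.integral_exp_sum _ fun w hw => (hc w hw).trans_lt haq]
    exact prod_ancestors m v fun l => 1 / (1 - a * q ^ (v.length + 1 - l))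
  · refine h.integral_exp_sum_le _ hc hc0 haq ?_
    rw [← Finset.mul_sum]
    refine mul_le_mul_of_nonneg_left ((Finset.sum_le_sum_of_subset_of_nonneg
      (Finset.filter_subset _ _) fun w _ _ => pow_nonneg hq.le _).trans
      ((Finset.sum_le_sum fun w hw => ?_).trans (sum_pow_ancestors_le hq hq1 v))) ha
    rw [Nat.succ_sub (length_le_of_mem_ancestors hw), pow_succ]
    exact mul_le_of_le_one_right (pow_nonneg hq.le _) hq1.le

theorem indepFun_truncated (h : IsExpFamily W P) (m : ℕ) (i : Fin k) (v : List (Fin k)) :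
    IndepFun (fun ω => q * truncated q (fun w => W w ω) m v) (W (i :: v)) P := by
  have hi : iIndepFun (fun w ω => q ^ ((i :: v).length - w.length) * W w ω) P :=
    h.indep.comp (fun w x => q ^ ((i :: v).length - w.length) * x) fun w => by fun_prop
  have h1 := hi.indepFun_finsetSum_of_notMem (fun w => (h.measurable w).const_mul _)
    (s := {w ∈ ancestors v | m < w.length}) (i := i :: v)
    (fun h' => cons_notMem_ancestors i v (Finset.mem_filter.1 h').1)
  convert h1 using 1
  · funext ω
    rw [truncated, Finset.sum_apply, Finset.mul_sum]
    refine Finset.sum_congr rfl fun w hw => ?_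
    rw [List.length_cons, Nat.succ_sub
      (length_le_of_mem_ancestors (Finset.mem_filter.1 hw).1), pow_succ]
    ring
  · funext ω
    simp

theorem measureReal_truncated_ge_le (h : IsExpFamily W P) [IsProbabilityMeasure P] (hq : 0 < q)
    (hq1 : q < 1) {m : ℕ} {v : List (Fin k)} (hv : m < v.length) (x : ℝ) :
    P.real {ω | x ≤ truncated q (fun w => W w ω) m v}
      ≤ Real.exp (1 / (1 - q) / (1 - q)) * Real.exp (-x) := by
  obtain _ | ⟨i, v⟩ := v
  · simp at hv
  rw [List.length_cons, Nat.lt_succ_iff] at hv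
  obtain ⟨h1, -, h3⟩ := h.integral_exp_tail hq hq1 zero_le_one (by linarith) m v
  simp only [one_mul] at h1 h3
  simp_rw [truncated_cons q _ i hv]
  refine (measureReal_add_ge_le (h.hasLaw (i :: v)) ((h.measurable_truncated m v).const_mul q)
    (h.indepFun_truncated m i v) h1 x).trans ?_
  gcongr

theorem norm_integral_truncated_sub_le (h : IsExpFamily W P) [IsProbabilityMeasure P] (hq : 0 < q)
    (hq1 : q < 1) {m : ℕ} {v : List (Fin k)} (hv : m < v.length) {f : ℝ → ℂ} (hf : Continuous f)
    {c A : ℝ} (hc : ∀ x, ‖f x‖ ≤ c) (hA : ∀ x, A < |x| → f x = 0) (t : ℝ) :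
    ‖Real.exp t * ∫ ω, f (truncated q (fun w => W w ω) m v - t) ∂P
        - (∏ l ∈ Finset.range (v.length - 1 - m), 1 / (1 - q ^ (l + 1)) : ℝ)
          * ∫ s, Real.exp (-s) * f s‖
      ≤ (∫ s, ‖Real.exp (-s) * f s‖) * (Real.exp (-((1 - q) / 2 * (t - A)))
        * Real.exp ((1 + (1 - q) / 2) * (1 / (1 - q)) / (1 - (1 + (1 - q) / 2) * q))) := by
  obtain _ | ⟨i, v⟩ := v
  · simp at hv
  rw [List.length_cons, Nat.lt_succ_iff] at hv
  obtain ⟨h1, h2, -⟩ := h.integral_exp_tail hq hq1 zero_le_one (by linarith) m v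
  obtain ⟨h1', -, h3'⟩ := h.integral_exp_tail (a := 1 + (1 - q) / 2) hq hq1 (by linarith)
    (by nlinarith) m v
  simp only [one_mul] at h1 h2
  have e : ∏ l ∈ Finset.Ioc m v.length, 1 / (1 - q ^ (v.length + 1 - l))
      = ∏ l ∈ Finset.range (v.length - m), 1 / (1 - q ^ (l + 1)) := by
    refine Finset.prod_nbij' (fun l => v.length - l) (fun l => v.length - l) ?_ ?_ ?_ ?_ ?_
    · intro l hl; rw [Finset.mem_Ioc] at hl; rw [Finset.mem_range]; omega
    · intro l hl; rw [Finset.mem_range] at hl; rw [Finset.mem_Ioc]; omega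
    · intro l hl; rw [Finset.mem_Ioc] at hl; omega
    · intro l hl; rw [Finset.mem_range] at hl; omega
    · intro l hl; rw [Finset.mem_Ioc] at hl
      rw [Nat.succ_sub hl.2]
  simp_rw [truncated_cons q _ i hv, List.length_cons, Nat.add_sub_cancel]
  rw [← e, ← h2]
  refine (norm_integral_add_sub_le (h.hasLaw (i :: v)) ((h.measurable_truncated m v).const_mul q)
    (h.indepFun_truncated m i v) (δ := (1 - q) / 2) (by linarith) h1 h1' hf hc hA t).trans ?_
  gcongr

end IsExpFamily

/-- The partial products of the Euler function converge. -/
theorem tendsto_prod_one_div {q : ℝ} (hq : 0 < q) (hq1 : q < 1) :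
    Tendsto (fun n => ∏ l ∈ Finset.range n, 1 / (1 - q ^ (l + 1))) atTop
      (𝓝 (1 / eulerFunction q)) ∧ 0 < eulerFunction q := by
  have hs : Summable fun i : ℕ => -q ^ (i + 1) :=
    ((summable_nat_add_iff 1).2 (summable_geometric_of_lt_one hq.le hq1)).neg
  have hm := Real.multipliable_one_add_of_summable hs
  have ht := hm.tendsto_prod_tprod_nat
  simp_rw [← sub_eq_add_neg] at ht
  have hlt : ∀ i : ℕ, 0 < 1 - q ^ (i + 1) := fun i => by
    have := pow_lt_one₀ hq.le hq1 i.add_one_ne_zero; linarith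
  have hpos : 0 < eulerFunction q := by
    have he := Real.rexp_tsum_eq_tprod (f := fun i : ℕ => 1 - q ^ (i + 1)) hlt (by
      simpa only [← sub_eq_add_neg] using Real.summable_log_one_add_of_summable hs)
    rw [eulerFunction, ← he]
    exact Real.exp_pos _
  refine ⟨?_, hpos⟩
  simp_rw [one_div, Finset.prod_inv_distrib]
  exact ht.inv₀ hpos.ne'

/-! ### Convergence of the generating functionals -/

/-- Continuous functions `f` supported in `[-A, A]` such that `1 + f` takes its values in the unit
disc. -/
structure IsDiscTest (f : ℝ → ℂ) (A : ℝ) : Prop where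
  continuous : Continuous f
  norm_one_add_le : ∀ x, ‖1 + f x‖ ≤ 1
  eq_zero : ∀ x, A < |x| → f x = 0

theorem IsDiscTest.norm_le {f : ℝ → ℂ} {A : ℝ} (hf : IsDiscTest f A) (x : ℝ) : ‖f x‖ ≤ 2 := by
  have h1 := norm_sub_le (1 + f x) 1
  rw [add_sub_cancel_left, norm_one] at h1
  linarith [hf.norm_one_add_le x]

theorem IsDiscTest.uniformContinuous {f : ℝ → ℂ} {A : ℝ} (hf : IsDiscTest f A) :
    UniformContinuous f := by
  refine HasCompactSupport.uniformContinuous_of_continuous ?_ hf.continuous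
  refine HasCompactSupport.intro (isCompact_Icc (a := -A) (b := A)) fun x hx => ?_
  exact hf.eq_zero x (by by_contra! h'; exact hx (abs_le.1 h'))

theorem IsDiscTest.norm_le_indicator {f : ℝ → ℂ} {A : ℝ} (hf : IsDiscTest f A) {Ω : Type*}
    (T : Ω → ℝ) (t : ℝ) (ω : Ω) :
    ‖f (T ω - t)‖ ≤ {ω | t - A ≤ T ω}.indicator (fun _ => (2 : ℝ)) ω := by
  by_cases hω : t - A ≤ T ω
  · rw [Set.indicator_of_mem (show ω ∈ {ω | t - A ≤ T ω} from hω)]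
    exact hf.norm_le _
  · rw [Set.indicator_of_notMem (show ω ∉ {ω | t - A ≤ T ω} from hω), hf.eq_zero, norm_zero]
    have := neg_abs_le (T ω - t)
    linarith [not_le.1 hω]

/-- The pairs `(i, a)` with `a` a word of length `j + i`: relative positions of the vertices of
generations `m + j, …, m + j + ℓ - 1` with respect to their ancestor in generation `m`. -/
def blockIndex (k ℓ j : ℕ) : Finset (Σ _ : Fin ℓ, List (Fin k)) :=
  Finset.univ.sigma fun i => words k (j + i)

theorem card_blockIndex_le {k : ℕ} (hk : 1 ≤ k) (ℓ j : ℕ) :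
    ((blockIndex k ℓ j).card : ℝ) ≤ ℓ * k ^ ℓ * k ^ j := by
  have : (blockIndex k ℓ j).card ≤ ℓ * k ^ ℓ * k ^ j := by
    rw [blockIndex, Finset.card_sigma]
    refine (Finset.sum_le_card_nsmul _ _ (k ^ ℓ * k ^ j) fun i _ => ?_).trans_eq ?_
    · rw [card_words, ← pow_add, add_comm]
      exact Nat.pow_le_pow_right hk (by omega)
    · simp [mul_assoc]
  exact_mod_cast this

theorem exp_mul_log {k : ℕ} (hk : 1 ≤ k) (n : ℕ) : Real.exp (n * Real.log k) = (k : ℝ) ^ n := by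
  rw [Real.exp_nat_mul, Real.exp_log (by exact_mod_cast hk)]

namespace IsExpFamily

variable {k : ℕ} {Ω : Type*} [MeasurableSpace Ω] {P : Measure Ω} {W : List (Fin k) → Ω → ℝ}
  {q A : ℝ} {ℓ : ℕ} {f : Fin ℓ → ℝ → ℂ}

/-- Independence of the truncated functionals attached to the vertices of generation `m`. -/
theorem integral_prod_truncated (h : IsExpFamily W P) (hf : ∀ i, IsDiscTest (f i) A) (m j : ℕ)
    (t : Fin ℓ → ℝ) :
    ∫ ω, ∏ u ∈ words k m, ∏ b ∈ blockIndex k ℓ j,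
        (1 + f b.1 (truncated q (fun w => W w ω) m (b.2 ++ u) - t b.1)) ∂P
      = ∏ u ∈ words k m, ∫ ω, ∏ b ∈ blockIndex k ℓ j,
        (1 + f b.1 (truncated q (fun w => W w ω) m (b.2 ++ u) - t b.1)) ∂P := by
  refine integral_prod_of_dependsOn h.measurable h.indep (fun u => descendants (j + ℓ) u)
    (words k m) ?_ (fun u x => ∏ b ∈ blockIndex k ℓ j,
      (1 + f b.1 (truncated q x m (b.2 ++ u) - t b.1))) ?_ ?_
  · intro u hu u' hu' hne
    rw [mem_words] at hu hu'
    exact disjoint_descendants (hu.trans hu'.symm) hne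
  · intro u
    refine Finset.measurable_fun_prod _ fun b _ =>
      ((hf b.1).continuous.measurable.comp ?_).const_add 1
    refine Measurable.sub_const ?_ _
    exact Finset.measurable_fun_sum _ fun w _ => (measurable_pi_apply w).const_mul _
  · intro u hu x y hxy
    rw [mem_words] at hu
    refine Finset.prod_congr rfl fun b hb => ?_
    rw [blockIndex, Finset.mem_sigma, mem_words] at hb
    subst hu
    rw [truncated_congr (d := j + ℓ) (by omega) hxy]

theorem norm_integral_test_le (h : IsExpFamily W P) [IsProbabilityMeasure P] (hq : 0 < q)
    (hq1 : q < 1) {g : ℝ → ℂ} (hg : IsDiscTest g A) {m : ℕ} {v : List (Fin k)}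
    (hv : m < v.length) (t : ℝ) :
    ‖∫ ω, g (truncated q (fun w => W w ω) m v - t) ∂P‖
      ≤ 2 * (Real.exp (1 / (1 - q) / (1 - q)) * Real.exp (-(t - A))) := by
  have hm : MeasurableSet {ω | t - A ≤ truncated q (fun w => W w ω) m v} :=
    measurableSet_le measurable_const (h.measurable_truncated m v)
  refine (norm_integral_le_of_norm_le ((integrable_const (2 : ℝ)).indicator hm)
    (Eventually.of_forall (hg.norm_le_indicator _ t))).trans ?_
  rw [integral_indicator_const _ hm, smul_eq_mul, mul_comm]
  gcongr
  exact h.measureReal_truncated_ge_le hq hq1 hv _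

theorem integral_pair_test_le (h : IsExpFamily W P) [IsProbabilityMeasure P] (hq : 0 < q)
    (hq1 : q < 1) {θ : ℝ} (hθ : 0 ≤ θ) (hθq : θ * (1 + q) < 1) {g g' : ℝ → ℂ}
    (hg : IsDiscTest g A) (hg' : IsDiscTest g' A) {m : ℕ} {v v' : List (Fin k)}
    (hv : v ≠ v') (t t' : ℝ) :
    ∫ ω, ‖g (truncated q (fun w => W w ω) m v - t)‖
        * ‖g' (truncated q (fun w => W w ω) m v' - t')‖ ∂P
      ≤ 4 * (Real.exp (θ * (2 / (1 - q)) / (1 - θ * (1 + q)))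
        * Real.exp (-θ * (t - A + (t' - A)))) := by
  set S := {ω | t - A ≤ truncated q (fun w => W w ω) m v ∧
    t' - A ≤ truncated q (fun w => W w ω) m v'} with hS
  have hm : MeasurableSet S :=
    (measurableSet_le measurable_const (h.measurable_truncated m v)).inter
    (measurableSet_le measurable_const (h.measurable_truncated m v'))
  refine (integral_mono_of_nonneg (Eventually.of_forall fun ω => by positivity)
    ((integrable_const (4 : ℝ)).indicator hm) (Eventually.of_forall fun ω => ?_)).trans ?_
  · have h1 := hg.norm_le_indicator (fun ω => truncated q (fun w => W w ω) m v) t ω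
    have h2 := hg'.norm_le_indicator (fun ω => truncated q (fun w => W w ω) m v') t' ω
    refine (mul_le_mul h1 h2 (norm_nonneg _) ((norm_nonneg _).trans h1)).trans_eq ?_
    simp only [Set.indicator, Set.mem_ofPred_eq, hS]
    by_cases ha : t - A ≤ truncated q (fun w => W w ω) m v <;>
      by_cases hb : t' - A ≤ truncated q (fun w => W w ω) m v' <;> simp [ha, hb]
    norm_num
  · rw [integral_indicator_const _ hm, smul_eq_mul, mul_comm]
    gcongr
    exact h.measureReal_pair_le hq hq1 hθ hθq hv m _ _

/-- Poisson approximation for the truncated positions. -/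
theorem norm_integral_prod_truncated_sub_le (h : IsExpFamily W P) [IsProbabilityMeasure P]
    (hk : 1 ≤ k) (hq : 0 < q) (hq1 : q < 1) {κ : ℝ} (hκ : 0 < κ) (hκ1 : κ ≤ 1 / 4)
    (hκq : (1 / 2 + κ) * (1 + q) < 1) (hf : ∀ i, IsDiscTest (f i) A) :
    ∃ C C' : ℝ, ∀ m j : ℕ, 1 ≤ j → (j : ℝ) ≤ κ * (m + j : ℕ) →
      C' * Real.exp (-(κ * ((m + j : ℕ) * Real.log k))) ≤ 1 →
      ‖∫ ω, ∏ u ∈ words k m, ∏ b ∈ blockIndex k ℓ j,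
          (1 + f b.1 (truncated q (fun w => W w ω) m (b.2 ++ u)
            - (m + j + b.1 : ℕ) * Real.log k)) ∂P
        - Complex.exp (∑ u ∈ words k m, ∑ b ∈ blockIndex k ℓ j,
          ∫ ω, f b.1 (truncated q (fun w => W w ω) m (b.2 ++ u)
            - (m + j + b.1 : ℕ) * Real.log k) ∂P)‖
        ≤ C * Real.exp (-(κ * ((m + j : ℕ) * Real.log k))) := by
  classical
  set θ : ℝ := 1 / 2 + κ with hθ
  set C₁ : ℝ := 2 * (Real.exp (1 / (1 - q) / (1 - q)) * Real.exp A) with hC₁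
  set C₃ : ℝ := 4 * (Real.exp (θ * (2 / (1 - q)) / (1 - θ * (1 + q)))
        * Real.exp (2 * θ * A)) with hC₃
  set b₀ : ℝ := ℓ * k ^ ℓ with hb₀
  refine ⟨b₀ ^ 2 * C₃ + (b₀ * C₁) ^ 2, b₀ * C₁, fun m j hj hjκ hone => ?_⟩
  set L : ℝ := (m + j : ℕ) * Real.log k with hL
  have hlog : 0 ≤ Real.log k := Real.log_nonneg (by exact_mod_cast hk)
  have hLi : ∀ i : ℕ, L ≤ (m + j + i : ℕ) * Real.log k := fun i =>
    mul_le_mul_of_nonneg_right (Nat.cast_le.2 (Nat.le_add_right _ _)) hlog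
  have hkj : (k : ℝ) ^ j ≤ Real.exp (κ * L) := by
    rw [← exp_mul_log hk, hL, ← mul_assoc]
    gcongr
  have hkm : (k : ℝ) ^ m * (k : ℝ) ^ j = Real.exp L := by
    rw [← pow_add, ← exp_mul_log hk]
  have hβ := card_blockIndex_le hk ℓ j
  set β : ℝ := ((blockIndex k ℓ j).card : ℝ) with hβ'
  have hb0 : 0 ≤ b₀ := by positivity
  have hL0 : 0 ≤ L := by positivity
  have hlen : ∀ u ∈ words k m, ∀ b ∈ blockIndex k ℓ j, m < (b.2 ++ u).length := by
    intro u hu b hb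
    rw [blockIndex, Finset.mem_sigma, mem_words] at hb
    rw [mem_words] at hu
    rw [List.length_append]
    omega
  have hβp : β * (C₁ * Real.exp (-L)) ≤ b₀ * C₁ * Real.exp (-(κ * L)) := by
    have e1 : Real.exp (κ * L) * Real.exp (-L) ≤ Real.exp (-(κ * L)) := by
      rw [← Real.exp_add]
      refine Real.exp_le_exp.2 ?_
      nlinarith
    calc β * (C₁ * Real.exp (-L)) ≤ b₀ * k ^ j * (C₁ * Real.exp (-L)) := by gcongr
      _ ≤ b₀ * Real.exp (κ * L) * (C₁ * Real.exp (-L)) := by gcongr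
      _ = b₀ * C₁ * (Real.exp (κ * L) * Real.exp (-L)) := by ring
      _ ≤ _ := by gcongr
  refine (norm_integral_prod_sub_exp_le (p := C₁ * Real.exp (-L))
    (r := C₃ * Real.exp (-(2 * θ * L))) (words k m) (blockIndex k ℓ j)
    (z := fun u b ω => f b.1 (truncated q (fun w => W w ω) m (b.2 ++ u)
            - (m + j + b.1 : ℕ) * Real.log k)) (by positivity)
    (fun u b => (hf b.1).continuous.measurable.comp ((h.measurable_truncated m _).sub_const _))
    (fun u b ω => (hf b.1).norm_one_add_le _)
    (h.integral_prod_truncated hf m j fun i => (m + j + i : ℕ) * Real.log k)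
    (fun u hu b hb => ?_) (hβp.trans hone) (fun u hu b hb b' hb' hbb => ?_)).trans ?_
  · refine (h.norm_integral_test_le hq hq1 (hf b.1) (hlen u hu b hb) _).trans ?_
    rw [hC₁, mul_assoc, mul_assoc, ← Real.exp_add A]
    gcongr
    linarith [hLi b.1]
  · refine (h.integral_pair_test_le hq hq1 (θ := θ) (by positivity) hκq (hf b.1) (hf b'.1)
      (fun he => hbb ?_) _ _).trans ?_
    · rw [blockIndex, Finset.mem_sigma, mem_words] at hb hb'
      have he' := List.append_cancel_right he
      obtain ⟨i, a⟩ := b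
      obtain ⟨i', a'⟩ := b'
      simp only at he' hb hb'
      subst he'
      have : i = i' := Fin.ext (by omega)
      rw [this]
    · rw [hC₃, mul_assoc, mul_assoc, ← Real.exp_add (2 * θ * A)]
      gcongr
      have := hLi b.1
      have := hLi b'.1
      have hθ0 : 0 ≤ θ := by positivity
      nlinarith
  · rw [card_words]
    push_cast
    have e1 : (k : ℝ) ^ m * (β * (β * (C₃ * Real.exp (-(2 * θ * L)))))
        ≤ b₀ ^ 2 * C₃ * Real.exp (-(κ * L)) := by
      calc (k : ℝ) ^ m * (β * (β * (C₃ * Real.exp (-(2 * θ * L)))))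
          ≤ (k : ℝ) ^ m * (b₀ * k ^ j * (b₀ * k ^ j * (C₃ * Real.exp (-(2 * θ * L))))) := by gcongr
        _ = b₀ ^ 2 * C₃ * ((k ^ m * k ^ j) * k ^ j * Real.exp (-(2 * θ * L))) := by ring
        _ ≤ b₀ ^ 2 * C₃ * (Real.exp L * Real.exp (κ * L) * Real.exp (-(2 * θ * L))) := by
          rw [hkm]; gcongr
        _ = b₀ ^ 2 * C₃ * Real.exp (-(κ * L)) := by
          rw [← Real.exp_add, ← Real.exp_add, hθ]; ring_nf
    have e2 : (k : ℝ) ^ m * (β * (C₁ * Real.exp (-L))) ^ 2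
        ≤ (b₀ * C₁) ^ 2 * Real.exp (-(κ * L)) := by
      have e3 : Real.exp L * Real.exp (κ * L) * Real.exp (-L) ^ 2 ≤ Real.exp (-(κ * L)) := by
        rw [pow_two, ← Real.exp_add, ← Real.exp_add, ← Real.exp_add]
        refine Real.exp_le_exp.2 ?_
        nlinarith
      calc (k : ℝ) ^ m * (β * (C₁ * Real.exp (-L))) ^ 2
          ≤ (k : ℝ) ^ m * (b₀ * k ^ j * (C₁ * Real.exp (-L))) ^ 2 := by gcongr
        _ = (b₀ * C₁) ^ 2 * ((k ^ m * k ^ j) * k ^ j * Real.exp (-L) ^ 2) := by ring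
        _ ≤ (b₀ * C₁) ^ 2 * (Real.exp L * Real.exp (κ * L) * Real.exp (-L) ^ 2) := by
          rw [hkm]; gcongr
        _ ≤ _ := by gcongr
    linarith

/-- Convergence of the first moments. -/
theorem norm_sum_integral_truncated_sub_le (h : IsExpFamily W P) [IsProbabilityMeasure P]
    (hk : 1 ≤ k) (hq : 0 < q) (hq1 : q < 1) (hf : ∀ i, IsDiscTest (f i) A) :
    ∃ C : ℝ, ∀ m j : ℕ, 1 ≤ j →
      ‖∑ u ∈ words k m, ∑ b ∈ blockIndex k ℓ j,
          ∫ ω, f b.1 (truncated q (fun w => W w ω) m (b.2 ++ u)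
            - (m + j + b.1 : ℕ) * Real.log k) ∂P
        - ∑ i : Fin ℓ, (∏ l ∈ Finset.range (j + i - 1), 1 / (1 - q ^ (l + 1)) : ℝ)
            * ∫ s, Real.exp (-s) * f i s‖
        ≤ C * Real.exp (-((1 - q) / 2 * ((m + j : ℕ) * Real.log k))) := by
  set D : ℝ := Real.exp ((1 - q) / 2 * A)
    * Real.exp ((1 + (1 - q) / 2) * (1 / (1 - q)) / (1 - (1 + (1 - q) / 2) * q)) with hD
  refine ⟨∑ i, (∫ s, ‖Real.exp (-s) * f i s‖) * D, fun m j hj => ?_⟩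
  set L : ℝ := (m + j : ℕ) * Real.log k with hL
  have hlog : 0 ≤ Real.log k := Real.log_nonneg (by exact_mod_cast hk)
  have hLi : ∀ i : ℕ, L ≤ (m + j + i : ℕ) * Real.log k := fun i =>
    mul_le_mul_of_nonneg_right (Nat.cast_le.2 (Nat.le_add_right _ _)) hlog
  have e1 : ∑ u ∈ words k m, ∑ b ∈ blockIndex k ℓ j,
      ∫ ω, f b.1 (truncated q (fun w => W w ω) m (b.2 ++ u)
        - (m + j + b.1 : ℕ) * Real.log k) ∂P
      = ∑ i : Fin ℓ, ∑ v ∈ words k (j + i + m),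
        ∫ ω, f i (truncated q (fun w => W w ω) m v - (m + j + i : ℕ) * Real.log k) ∂P := by
    simp_rw [blockIndex, Finset.sum_sigma]
    rw [Finset.sum_comm]
    refine Finset.sum_congr rfl fun i _ => ?_
    rw [sum_words_add]
  rw [e1, ← Finset.sum_sub_distrib, Finset.sum_mul]
  refine (norm_sum_le _ _).trans (Finset.sum_le_sum fun i _ => ?_)
  set t : ℝ := (m + j + i : ℕ) * Real.log k with ht
  set c : ℂ := (∏ l ∈ Finset.range (j + i - 1), 1 / (1 - q ^ (l + 1)) : ℝ)
            * ∫ s, Real.exp (-s) * f i s with hc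
  have hcard : ((words k (j + i + m)).card : ℝ) = Real.exp t := by
    rw [card_words, ht, exp_mul_log hk]
    push_cast
    congr 1
    omega
  have e2 : c = ∑ v ∈ words k (j + i + m), Real.exp (-t) * c := by
    rw [Finset.sum_const, nsmul_eq_mul, ← mul_assoc]
    have : (((words k (j + i + m)).card : ℂ)) = (Real.exp t : ℂ) := by rw [← hcard]; simp
    rw [this, ← Complex.ofReal_mul, ← Real.exp_add, add_neg_cancel, Real.exp_zero,
      Complex.ofReal_one, one_mul]
  rw [e2, ← Finset.sum_sub_distrib]
  refine (norm_sum_le _ _).trans ((Finset.sum_le_card_nsmul _ _ (Real.exp (-t)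
    * ((∫ s, ‖Real.exp (-s) * f i s‖) * D * Real.exp (-((1 - q) / 2 * L))))
    fun v hv => ?_).trans_eq ?_)
  · rw [mem_words] at hv
    have h1 := h.norm_integral_truncated_sub_le hq hq1 (m := m) (v := v) (by omega)
      (hf i).continuous (hf i).norm_le (hf i).eq_zero t
    rw [show v.length - 1 - m = j + i - 1 by omega, ← hc] at h1
    have e3 : ∫ ω, f i (truncated q (fun w => W w ω) m v - t) ∂P - Real.exp (-t) * c
        = Real.exp (-t)
          * (Real.exp t * ∫ ω, f i (truncated q (fun w => W w ω) m v - t) ∂P - c) := by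
      rw [mul_sub, ← mul_assoc (Real.exp (-t) : ℂ) (Real.exp t : ℂ), ← Complex.ofReal_mul,
        ← Real.exp_add, neg_add_cancel,
        Real.exp_zero, Complex.ofReal_one, one_mul]
    rw [e3, norm_mul, Complex.norm_real, Real.norm_of_nonneg (Real.exp_nonneg _)]
    refine mul_le_mul_of_nonneg_left (h1.trans ?_) (Real.exp_nonneg _)
    rw [mul_assoc, hD]
    refine mul_le_mul_of_nonneg_left ?_ (integral_nonneg fun _ => norm_nonneg _)
    rw [mul_right_comm, ← Real.exp_add ((1 - q) / 2 * A)]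
    gcongr
    have := hLi i
    nlinarith
  · rw [nsmul_eq_mul, hcard, ← mul_assoc, ← Real.exp_add, add_neg_cancel, Real.exp_zero, one_mul]

end IsExpFamily

theorem tendsto_exp_linear_sub_pow (a : ℝ) {b r : ℝ} (hb : 0 < b) (hr : 1 < r) :
    Tendsto (fun j : ℕ => Real.exp (a * (j + 1 : ℕ) - b * r ^ j)) atTop (𝓝 0) := by
  refine Real.tendsto_exp_atBot.comp ?_
  have h0 : 0 < r := one_pos.trans hr
  have h1 : Tendsto (fun j : ℕ => a * ((j : ℝ) / r ^ j + (r⁻¹) ^ j) - b) atTop (𝓝 (-b)) := by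
    have e1 := tendsto_pow_const_div_const_pow_of_one_lt 1 hr
    have e2 := tendsto_pow_atTop_nhds_zero_of_lt_one (inv_nonneg.2 h0.le) (inv_lt_one_of_one_lt₀ hr)
    simp only [pow_one] at e1
    simpa using ((e1.add e2).const_mul a).sub_const b
  refine ((tendsto_pow_atTop_atTop_of_one_lt hr).atTop_mul_neg (neg_neg_of_pos hb) h1).congr
    fun j => ?_
  have : r ^ j ≠ 0 := (pow_pos h0 j).ne'
  rw [inv_pow]
  field_simp
  push_cast
  ring

namespace IsExpFamily

variable {k : ℕ} {Ω : Type*} [MeasurableSpace Ω] {P : Measure Ω} {W : List (Fin k) → Ω → ℝ}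
  {q A : ℝ} {ℓ : ℕ} {f : Fin ℓ → ℝ → ℂ}

theorem integral_norm_sub_le (h : IsExpFamily W P) [IsProbabilityMeasure P] (hq : 0 < q)
    (hq1 : q < 1) {g : ℝ → ℂ} (hg : IsDiscTest g A) {ε η : ℝ} (hε : 0 ≤ ε) (hη1 : η ≤ 1)
    (hgη : ∀ x y, |x - y| < η → ‖g x - g y‖ ≤ ε) {a u : List (Fin k)} (ha : 1 ≤ a.length) (t : ℝ) :
    ∫ ω, ‖g (rescaled q (fun w => W w ω) (a ++ u) - t)
        - g (truncated q (fun w => W w ω) u.length (a ++ u) - t)‖ ∂P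
      ≤ ε * (Real.exp (1 / (1 - q) / (1 - q)) * Real.exp (-(t - (A + 1))))
        + 4 * (Real.exp (1 / (1 - q)) * Real.exp (-(η / q ^ a.length) / 2)) := by
  set S := {ω | t - (A + 1) ≤ truncated q (fun w => W w ω) u.length (a ++ u)} with hS
  set S' := {ω | η / q ^ a.length ≤ rescaled q (fun w => W w ω) u} with hS'
  have hm : MeasurableSet S := measurableSet_le measurable_const (h.measurable_truncated _ _)
  have hm' : MeasurableSet S' := measurableSet_le measurable_const (h.measurable_rescaled hq u)
  have hi : Integrable (S.indicator fun _ => ε) P := (integrable_const ε).indicator hm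
  have hi' : Integrable (S'.indicator fun _ => (4 : ℝ)) P := (integrable_const 4).indicator hm'
  refine (integral_mono_of_nonneg (Eventually.of_forall fun ω => norm_nonneg _) (hi.add hi')
    (Eventually.of_forall fun ω => ?_)).trans ?_
  · have hqa : 0 < q ^ a.length := pow_pos hq _
    have hK := rescaled_append hq.ne' (fun w => W w ω) a u
    have hK0 : 0 ≤ rescaled q (fun w => W w ω) u :=
      (truncated_nonneg hq (fun w => h.nonneg w ω) 0 u).trans
        (truncated_le hq (fun w => h.nonneg w ω) 0 u)
    set T := truncated q (fun w => W w ω) u.length (a ++ u) with hT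
    simp only [Pi.add_apply]
    have h1 : 0 ≤ S.indicator (fun _ => ε) ω := Set.indicator_nonneg (fun _ _ => hε) ω
    have h2 : 0 ≤ S'.indicator (fun _ => (4 : ℝ)) ω :=
      Set.indicator_nonneg (fun _ _ => by norm_num) ω
    by_cases hω' : ω ∈ S'
    · rw [Set.indicator_of_mem hω']
      refine (norm_sub_le _ _).trans ?_
      linarith [hg.norm_le (rescaled q (fun w => W w ω) (a ++ u) - t), hg.norm_le (T - t)]
    · have h3 : q ^ a.length * rescaled q (fun w => W w ω) u < η := by
        have := not_le.1 (show ¬ η / q ^ a.length ≤ rescaled q (fun w => W w ω) u from hω')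
        rwa [lt_div_iff₀ hqa, mul_comm] at this
      have h4 : 0 ≤ q ^ a.length * rescaled q (fun w => W w ω) u := by positivity
      by_cases hω : ω ∈ S
      · rw [Set.indicator_of_mem hω]
        refine (hgη _ _ ?_).trans (le_add_of_nonneg_right h2)
        rw [hK, abs_of_nonneg (by linarith)]
        linarith
      · have h5 : T < t - (A + 1) := not_le.1 hω
        have h6 := neg_abs_le (T - t)
        have h7 := neg_abs_le (rescaled q (fun w => W w ω) (a ++ u) - t)
        rw [hg.eq_zero (T - t) (by linarith),
          hg.eq_zero (rescaled q (fun w => W w ω) (a ++ u) - t) (by linarith), sub_zero, norm_zero]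
        positivity
  · simp only [Pi.add_apply]
    rw [integral_add hi hi', integral_indicator_const _ hm, integral_indicator_const _ hm',
      smul_eq_mul, smul_eq_mul, mul_comm, mul_comm (P.real S')]
    refine add_le_add (mul_le_mul_of_nonneg_left ?_ hε) (mul_le_mul_of_nonneg_left ?_ (by norm_num))
    · exact h.measureReal_truncated_ge_le hq hq1 (by rw [List.length_append]; omega) _
    · exact h.measureReal_rescaled_ge_le hq hq1 u _

/-- The rescaled positions may be replaced by the truncated ones. -/
theorem norm_integral_prod_rescaled_sub_le (h : IsExpFamily W P) [IsProbabilityMeasure P]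
    (hk : 1 ≤ k) (hq : 0 < q) (hq1 : q < 1) (hf : ∀ i, IsDiscTest (f i) A)
    {ε η : ℝ} (hε : 0 ≤ ε) (hη : 0 ≤ η) (hη1 : η ≤ 1)
    (hfη : ∀ i x y, |x - y| < η → ‖f i x - f i y‖ ≤ ε) {m j : ℕ} (hj : 1 ≤ j) :
    ‖∫ ω, ∏ u ∈ words k m, ∏ b ∈ blockIndex k ℓ j,
          (1 + f b.1 (rescaled q (fun w => W w ω) (b.2 ++ u) - (m + j + b.1 : ℕ) * Real.log k)) ∂P
      - ∫ ω, ∏ u ∈ words k m, ∏ b ∈ blockIndex k ℓ j,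
          (1 + f b.1 (truncated q (fun w => W w ω) m (b.2 ++ u)
            - (m + j + b.1 : ℕ) * Real.log k)) ∂P‖
      ≤ ℓ * k ^ ℓ * (ε * (Real.exp (1 / (1 - q) / (1 - q)) * Real.exp (A + 1))
        + 4 * Real.exp (1 / (1 - q))
          * Real.exp ((m + j : ℕ) * Real.log k - η / 2 * q⁻¹ ^ j)) := by
  set L : ℝ := (m + j : ℕ) * Real.log k with hL
  have hlog : 0 ≤ Real.log k := Real.log_nonneg (by exact_mod_cast hk)
  have hLi : ∀ i : ℕ, L ≤ (m + j + i : ℕ) * Real.log k := fun i =>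
    mul_le_mul_of_nonneg_right (Nat.cast_le.2 (Nat.le_add_right _ _)) hlog
  have hmeasK : ∀ b : (Σ _ : Fin ℓ, List (Fin k)), ∀ u, Measurable fun ω =>
      f b.1 (rescaled q (fun w => W w ω) (b.2 ++ u) - (m + j + b.1 : ℕ) * Real.log k) :=
    fun b u => (hf b.1).continuous.measurable.comp ((h.measurable_rescaled hq _).sub_const _)
  have hmeasT : ∀ b : (Σ _ : Fin ℓ, List (Fin k)), ∀ u, Measurable fun ω =>
      f b.1 (truncated q (fun w => W w ω) m (b.2 ++ u) - (m + j + b.1 : ℕ) * Real.log k) :=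
    fun b u => (hf b.1).continuous.measurable.comp ((h.measurable_truncated m _).sub_const _)
  have hbdd : ∀ g : List (Fin k) → (Σ _ : Fin ℓ, List (Fin k)) → Ω → ℂ,
      (∀ u b, Measurable (g u b)) → (∀ u b ω, ‖1 + g u b ω‖ ≤ 1) →
      Integrable (fun ω => ∏ u ∈ words k m, ∏ b ∈ blockIndex k ℓ j, (1 + g u b ω)) P :=
    fun g hg hg1 => Integrable.of_bound (Finset.measurable_fun_prod _ fun u _ =>
      Finset.measurable_fun_prod _ fun b _ => (hg u b).const_add 1).aestronglyMeasurable 1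
      (Eventually.of_forall fun ω => norm_prod_le_one _ fun u _ => norm_prod_le_one _ fun b _ =>
        hg1 u b ω)
  have hdi : ∀ b : (Σ _ : Fin ℓ, List (Fin k)), ∀ u, Integrable (fun ω =>
      ‖f b.1 (rescaled q (fun w => W w ω) (b.2 ++ u) - (m + j + b.1 : ℕ) * Real.log k)
        - f b.1 (truncated q (fun w => W w ω) m (b.2 ++ u)
          - (m + j + b.1 : ℕ) * Real.log k)‖) P := fun b u =>
    (Integrable.of_bound ((hmeasK b u).sub (hmeasT b u)).aestronglyMeasurable 4
      (Eventually.of_forall fun ω => (norm_sub_le _ _).trans (by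
        linarith [(hf b.1).norm_le (rescaled q (fun w => W w ω) (b.2 ++ u)
            - (m + j + b.1 : ℕ) * Real.log k),
          (hf b.1).norm_le (truncated q (fun w => W w ω) m (b.2 ++ u)
            - (m + j + b.1 : ℕ) * Real.log k)]))).norm
  rw [← integral_sub (hbdd _ (fun u b => hmeasK b u) fun u b ω => (hf b.1).norm_one_add_le _)
    (hbdd _ (fun u b => hmeasT b u) fun u b ω => (hf b.1).norm_one_add_le _)]
  refine (norm_integral_le_of_norm_le (integrable_finsetSum (words k m) fun u _ =>
    integrable_finsetSum (blockIndex k ℓ j) fun b _ => hdi b u) (Eventually.of_forall fun ω =>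
    (norm_prod_sub_prod_le _ (fun u _ => norm_prod_le_one _ fun b _ => (hf b.1).norm_one_add_le _)
      fun u _ => norm_prod_le_one _ fun b _ => (hf b.1).norm_one_add_le _).trans
    (Finset.sum_le_sum fun u _ => (norm_prod_sub_prod_le _ (fun b _ => (hf b.1).norm_one_add_le _)
      fun b _ => (hf b.1).norm_one_add_le _).trans_eq
      (Finset.sum_congr rfl fun b _ => by rw [add_sub_add_left_eq_sub])))).trans ?_
  rw [integral_finsetSum _ fun u _ => integrable_finsetSum _ fun b _ => hdi b u]
  set D : ℝ := ε * (Real.exp (1 / (1 - q) / (1 - q)) * Real.exp (A + 1))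
        + 4 * Real.exp (1 / (1 - q)) * Real.exp (L - η / 2 * q⁻¹ ^ j) with hD
  have hD0 : 0 ≤ D := by positivity
  have hterm : ∀ u ∈ words k m, ∀ b ∈ blockIndex k ℓ j, ∫ ω,
      ‖f b.1 (rescaled q (fun w => W w ω) (b.2 ++ u) - (m + j + b.1 : ℕ) * Real.log k)
        - f b.1 (truncated q (fun w => W w ω) m (b.2 ++ u)
          - (m + j + b.1 : ℕ) * Real.log k)‖ ∂P ≤ Real.exp (-L) * D := by
    intro u hu b hb
    rw [blockIndex, Finset.mem_sigma, mem_words] at hb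
    rw [mem_words] at hu
    subst hu
    refine (h.integral_norm_sub_le hq hq1 (hf b.1) hε hη1 (hfη b.1) (by omega) _).trans ?_
    rw [hD, mul_add]
    refine add_le_add ?_ ?_
    · rw [mul_left_comm (Real.exp (-L)), mul_left_comm (Real.exp (-L)), ← Real.exp_add (-L)]
      gcongr
      linarith [hLi b.1]
    · rw [mul_left_comm (Real.exp (-L)), ← Real.exp_add (-L), mul_assoc]
      gcongr
      have h1 : q⁻¹ ^ j ≤ q⁻¹ ^ b.2.length := by
        refine pow_le_pow_right₀ ((one_le_inv₀ hq).2 hq1.le) (by omega)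
      have h2 : η / q ^ b.2.length = η * q⁻¹ ^ b.2.length := by rw [inv_pow]; rfl
      rw [h2]
      nlinarith
  refine (Finset.sum_le_card_nsmul _ _ ((blockIndex k ℓ j).card * (Real.exp (-L) * D))
    fun u hu => ?_).trans ?_
  · rw [integral_finsetSum _ fun b _ => hdi b u, ← nsmul_eq_mul]
    exact Finset.sum_le_card_nsmul _ _ _ fun b hb => hterm u hu b hb
  · rw [nsmul_eq_mul, card_words]
    push_cast
    have hβ := card_blockIndex_le hk ℓ j
    calc (k : ℝ) ^ m * ((blockIndex k ℓ j).card * (Real.exp (-L) * D))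
        ≤ (k : ℝ) ^ m * (ℓ * k ^ ℓ * k ^ j * (Real.exp (-L) * D)) := by gcongr
      _ = ℓ * k ^ ℓ * ((k : ℝ) ^ (m + j) * Real.exp (-L)) * D := by ring
      _ = ℓ * k ^ ℓ * D := by
        rw [← exp_mul_log hk (m + j), ← Real.exp_add, ← hL, add_neg_cancel, Real.exp_zero, mul_one]

/-- Convergence of the joint generating functionals of `ℓ` consecutive generations. -/
theorem tendsto_integral_prod_rescaled (h : IsExpFamily W P) [IsProbabilityMeasure P]
    (hk : 2 ≤ k) (hq : 0 < q) (hq1 : q < 1) (hf : ∀ i, IsDiscTest (f i) A) :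
    Tendsto (fun n : ℕ => ∫ ω, ∏ i : Fin ℓ, ∏ v ∈ words k (n + i),
        (1 + f i (rescaled q (fun w => W w ω) v - (n + i : ℕ) * Real.log k)) ∂P) atTop
      (𝓝 (Complex.exp (∑ i, (1 / eulerFunction q : ℝ) * ∫ s, Real.exp (-s) * f i s))) := by
  have hk1 : 1 ≤ k := by omega
  have hlog : 0 < Real.log k := Real.log_pos (by exact_mod_cast hk)
  set κ : ℝ := (1 / (1 + q) - 1 / 2) / 2 with hκ
  have hq2 : 0 < 1 + q := by linarith
  have hκ0 : 0 < κ := by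
    have : 1 / 2 < 1 / (1 + q) := one_div_lt_one_div_of_lt hq2 (by linarith)
    rw [hκ]; linarith
  have hκ1 : κ ≤ 1 / 4 := by
    have : 1 / (1 + q) ≤ 1 := by rw [div_le_one hq2]; linarith
    rw [hκ]; linarith
  have hκq : (1 / 2 + κ) * (1 + q) < 1 := by
    have : (1 / 2 + κ) * (1 + q) = (1 + (1 + q) / 2) / 2 := by rw [hκ]; field_simp; ring
    rw [this]; linarith
  set j : ℕ → ℕ := fun n => ⌊κ * n⌋₊ with hj
  have hjt : Tendsto j atTop atTop :=
    tendsto_nat_floor_atTop.comp (tendsto_natCast_atTop_atTop.const_mul_atTop hκ0)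
  have hjκ : ∀ n, (j n : ℝ) ≤ κ * n := fun n => Nat.floor_le (by positivity)
  have hjn : ∀ n, j n ≤ n := fun n => by
    have h1 := hjκ n
    have h2 : κ * n ≤ n := by
      have : (0 : ℝ) ≤ n := Nat.cast_nonneg n
      nlinarith
    exact_mod_cast h1.trans h2
  have hmj : ∀ n, n - j n + j n = n := fun n => Nat.sub_add_cancel (hjn n)
  set K : ℕ → ℂ := fun n => ∫ ω, ∏ i : Fin ℓ, ∏ v ∈ words k (n + i),
        (1 + f i (rescaled q (fun w => W w ω) v - (n + i : ℕ) * Real.log k)) ∂P with hK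
  have hKeq : ∀ n, K n = ∫ ω, ∏ u ∈ words k (n - j n), ∏ b ∈ blockIndex k ℓ (j n),
          (1 + f b.1 (rescaled q (fun w => W w ω) (b.2 ++ u)
            - (n + b.1 : ℕ) * Real.log k)) ∂P := by
    intro n
    refine integral_congr_ae (Eventually.of_forall fun ω => ?_)
    simp only [blockIndex, Finset.prod_sigma]
    rw [Finset.prod_comm]
    refine Finset.prod_congr rfl fun i _ => ?_
    rw [← prod_words_add (fun v => 1 + f i (rescaled q (fun w => W w ω) v
      - (n + i : ℕ) * Real.log k)),
      show j n + i + (n - j n) = n + i by have := hmj n; omega]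
  set Tr : ℕ → ℂ := fun n => ∫ ω, ∏ u ∈ words k (n - j n), ∏ b ∈ blockIndex k ℓ (j n),
          (1 + f b.1 (truncated q (fun w => W w ω) (n - j n) (b.2 ++ u)
            - (n + b.1 : ℕ) * Real.log k)) ∂P with hTr
  set Ex : ℕ → ℂ := fun n => ∑ u ∈ words k (n - j n), ∑ b ∈ blockIndex k ℓ (j n),
          ∫ ω, f b.1 (truncated q (fun w => W w ω) (n - j n) (b.2 ++ u)
            - (n + b.1 : ℕ) * Real.log k) ∂P with hEx
  have hj1 : ∀ᶠ n in atTop, 1 ≤ j n := hjt.eventually_ge_atTop 1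
  have hexp : ∀ c : ℝ, 0 < c → Tendsto (fun n : ℕ => Real.exp (-(c * (n * Real.log k)))) atTop
      (𝓝 0) := fun c hc => Real.tendsto_exp_neg_atTop_nhds_zero.comp
    ((tendsto_natCast_atTop_atTop.atTop_mul_const hlog).const_mul_atTop hc)
  have hExlim : Tendsto Ex atTop
      (𝓝 (∑ i, (1 / eulerFunction q : ℝ) * ∫ s, Real.exp (-s) * f i s)) := by
    obtain ⟨C, hC⟩ := h.norm_sum_integral_truncated_sub_le hk1 hq hq1 hf
    have h1 : Tendsto (fun n => ∑ i : Fin ℓ,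
        ((∏ l ∈ Finset.range (j n + i - 1), 1 / (1 - q ^ (l + 1)) : ℝ) : ℂ)
          * ∫ s, Real.exp (-s) * f i s) atTop
        (𝓝 (∑ i, (1 / eulerFunction q : ℝ) * ∫ s, Real.exp (-s) * f i s)) := by
      refine tendsto_finsetSum _ fun i _ => Tendsto.mul_const _ ?_
      refine (Complex.continuous_ofReal.tendsto _).comp
        ((tendsto_prod_one_div hq hq1).1.comp ?_)
      refine tendsto_atTop_mono (fun n => ?_) ((tendsto_sub_atTop_nat 1).comp hjt)
      simp only [Function.comp]
      omega
    refine tendsto_of_tendsto_of_dist h1 ?_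
    refine squeeze_zero' (Eventually.of_forall fun n => dist_nonneg) (g := fun n : ℕ =>
      C * Real.exp (-((1 - q) / 2 * (n * Real.log k)))) ?_ ?_
    · filter_upwards [hj1] with n hn
      have := hC (n - j n) (j n) hn
      rw [dist_comm, dist_eq_norm]
      simpa only [hmj] using this
    · simpa using (hexp _ (by linarith)).const_mul C
  have hTrlim : Tendsto (fun n => ‖Tr n - Complex.exp (Ex n)‖) atTop (𝓝 0) := by
    obtain ⟨C, C', hC⟩ := h.norm_integral_prod_truncated_sub_le hk1 hq hq1 hκ0 hκ1 hκq hf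
    refine squeeze_zero' (Eventually.of_forall fun n => norm_nonneg _) (g := fun n : ℕ =>
      C * Real.exp (-(κ * (n * Real.log k)))) ?_ ?_
    · have h1 : ∀ᶠ n : ℕ in atTop, C' * Real.exp (-(κ * (n * Real.log k))) < 1 := by
        have := (hexp κ hκ0).const_mul C'
        rw [mul_zero] at this
        exact this.eventually_lt_const one_pos
      filter_upwards [hj1, h1] with n hn hn'
      have := hC (n - j n) (j n) hn
      simp only [hmj] at this
      exact this (hjκ n) hn'.le
    · simpa using (hexp _ hκ0).const_mul C
  have hKlim : Tendsto (fun n => ‖K n - Tr n‖) atTop (𝓝 0) := by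
    set M : ℝ := ℓ * k ^ ℓ with hM
    set c₁ : ℝ := Real.exp (1 / (1 - q) / (1 - q)) * Real.exp (A + 1) with hc₁
    set c₂ : ℝ := 4 * Real.exp (1 / (1 - q)) with hc₂
    have hM0 : 0 ≤ M := by positivity
    have hc0 : 0 < c₁ := by positivity
    rw [Metric.tendsto_nhds]
    intro δ hδ
    set ε : ℝ := δ / (2 * (M * c₁ + 1)) with hε
    have hε0 : 0 < ε := by positivity
    have hη : ∀ᶠ η : ℝ in 𝓝[>] 0, ∀ i x y, |x - y| < η → ‖f i x - f i y‖ ≤ ε := by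
      refine eventually_all.2 fun i => ?_
      obtain ⟨η, hη0, hη⟩ := Metric.uniformContinuous_iff.1 (hf i).uniformContinuous ε hε0
      filter_upwards [Ioo_mem_nhdsGT hη0] with η' hη' x y hxy
      rw [← dist_eq_norm]
      exact (hη (hxy.trans hη'.2)).le
    obtain ⟨η, hη, hη0, hη1⟩ := (hη.and (Ioo_mem_nhdsGT (one_pos (α := ℝ)))).exists
    have hsmall := (tendsto_exp_linear_sub_pow (Real.log k / κ) (half_pos hη0)
      ((one_lt_inv₀ hq).2 hq1)).comp hjt
    have hsmall' : Tendsto (fun n => M * (c₂ * Real.exp (Real.log k / κ * (j n + 1 : ℕ)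
        - η / 2 * q⁻¹ ^ j n))) atTop (𝓝 0) := by
      simpa using (hsmall.const_mul c₂).const_mul M
    filter_upwards [hj1, hsmall'.eventually_lt_const (half_pos hδ)] with n hn hn'
    have := h.norm_integral_prod_rescaled_sub_le hk1 hq hq1 hf hε0.le hη0.le hη1.le hη
      (m := n - j n) hn
    simp only [hmj] at this
    rw [Real.dist_eq, sub_zero, abs_of_nonneg (norm_nonneg _), hKeq]
    refine this.trans_lt ?_
    have h1 : (n : ℝ) * Real.log k ≤ Real.log k / κ * (j n + 1 : ℕ) := by
      have h2 := Nat.lt_floor_add_one (κ * n)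
      rw [div_mul_eq_mul_div, le_div_iff₀ hκ0]
      push_cast
      nlinarith
    have h2 : M * (c₂ * Real.exp (n * Real.log k - η / 2 * q⁻¹ ^ j n)) < δ / 2 := by
      refine lt_of_le_of_lt ?_ hn'
      gcongr
    have h3 : M * (ε * c₁) < δ / 2 := by
      have : M * (ε * c₁) = δ / 2 * (M * c₁ / (M * c₁ + 1)) := by rw [hε]; field_simp
      rw [this]
      refine mul_lt_of_lt_one_right (half_pos hδ) ?_
      rw [div_lt_one (by positivity)]
      linarith
    rw [mul_add]
    linarith
  have h1 : Tendsto (fun n => Complex.exp (Ex n)) atTop (𝓝 (Complex.exp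
      (∑ i, (1 / eulerFunction q : ℝ) * ∫ s, Real.exp (-s) * f i s))) :=
    (Complex.continuous_exp.tendsto _).comp hExlim
  have h2 := (tendsto_zero_iff_norm_tendsto_zero.2 hKlim).add
    ((tendsto_zero_iff_norm_tendsto_zero.2 hTrlim).add h1)
  simpa using h2

end IsExpFamily

/-! ### Characteristic functionals of the point processes and of their limits -/

theorem integral_pointProcess {k : ℕ} (q : ℝ) (W : List (Fin k) → ℝ) (n : ℕ) {E : Type*}
    [NormedAddCommGroup E] [NormedSpace ℝ E] [CompleteSpace E] (g : ℝ → E) :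
    ∫ x, g x ∂(pointProcess q W n).toMeasure
      = ∑ v ∈ words k n, g (rescaled q W v - n * Real.log k) := by
  change ∫ x, g x ∂(∑ v : List.Vector (Fin k) n,
    Measure.dirac (rescaled q W v.toList - (n : ℝ) * Real.log k)) = _
  rw [integral_finsetSum_measure fun v _ => integrable_dirac (by simp)]
  simp_rw [integral_dirac]
  exact sum_vector fun v => g (rescaled q W v - n * Real.log k)

theorem IsExpFamily.measurable_pointProcess {k : ℕ} {Ω : Type*} [MeasurableSpace Ω]
    {P : Measure Ω} {W : List (Fin k) → Ω → ℝ} (h : IsExpFamily W P) {q : ℝ} (hq : 0 < q) (n : ℕ) :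
    Measurable fun ω => pointProcess q (fun v => W v ω) n := by
  refine measurable_comap_iff.2 (Measure.measurable_of_measurable_coe _ fun s hs => ?_)
  have e : ∀ ω, (LFMeasure.toMeasure ∘ fun ω => pointProcess q (fun v => W v ω) n) ω s
      = ∑ v : List.Vector (Fin k) n, s.indicator 1
        (rescaled q (fun v => W v ω) v.toList - (n : ℝ) * Real.log k) := by
    intro ω
    change (∑ v : List.Vector (Fin k) n, Measure.dirac
      (rescaled q (fun v => W v ω) v.toList - (n : ℝ) * Real.log k)) s = _
    rw [Measure.finsetSum_apply]
    exact Finset.sum_congr rfl fun v _ => Measure.dirac_apply' _ hs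
  simp_rw [e]
  exact Finset.measurable_fun_sum _ fun v _ => (measurable_one.indicator hs).comp
    ((h.measurable_rescaled hq _).sub_const _)

instance (q : ℝ) : IsLocallyFiniteMeasure (intensity q) :=
  IsLocallyFiniteMeasure.withDensity_ofReal (by fun_prop)

theorem integral_intensity {q : ℝ} (hq : 0 < eulerFunction q) (f : ℝ → ℂ) :
    ∫ s, f s ∂(intensity q) = (1 / eulerFunction q : ℝ) * ∫ s, Real.exp (-s) * f s := by
  rw [intensity, integral_withDensity_eq_integral_toReal_smul (by fun_prop) (by simp),
    ← integral_const_mul]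
  refine integral_congr_ae (Eventually.of_forall fun s => ?_)
  simp only
  rw [ENNReal.toReal_ofReal (by positivity), Complex.real_smul]
  push_cast
  ring

theorem isDiscTest_exp (g : C_c(ℝ, ℝ)) : ∃ A₀ : ℝ, ∀ A ≥ A₀,
    IsDiscTest (fun x => Complex.exp (g x * Complex.I) - 1) A := by
  obtain ⟨A₀, hA₀⟩ := g.hasCompactSupport.isCompact.isBounded.subset_closedBall (0 : ℝ)
  refine ⟨A₀, fun A hA => ⟨?_, fun x => ?_, fun x hx => ?_⟩⟩
  · have := g.continuous
    fun_prop
  · rw [add_sub_cancel, Complex.norm_exp_ofReal_mul_I]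
  · have hgx : g x = 0 := image_eq_zero_of_notMem_tsupport fun hmem => by
      have := hA₀ hmem
      rw [Metric.mem_closedBall, Real.dist_eq, sub_zero] at this
      linarith
    simp [hgx]

/-- Convergence of the characteristic functionals of `ℓ` consecutive generations. -/
theorem IsExpFamily.tendsto_characteristic {k : ℕ} {Ω : Type*} [MeasurableSpace Ω] {P : Measure Ω}
    [IsProbabilityMeasure P] {W : List (Fin k) → Ω → ℝ} (h : IsExpFamily W P) (hk : 2 ≤ k) {q : ℝ}
    (hq : 0 < q) (hq1 : q < 1) {ℓ : ℕ} (g : Fin ℓ → C_c(ℝ, ℝ)) :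
    Tendsto (fun n : ℕ => ∫ ω, Complex.exp ((∑ i : Fin ℓ,
        ∫ x, g i x ∂(pointProcess q (fun v => W v ω) (n + i)).toMeasure : ℝ) * Complex.I) ∂P) atTop
      (𝓝 (∏ i, Complex.exp (∫ x, (Complex.exp (g i x * Complex.I) - 1) ∂(intensity q)))) := by
  choose A₀ hA₀ using fun i => isDiscTest_exp (g i)
  obtain ⟨A, hA⟩ := (Set.finite_range A₀).bddAbove
  have hf : ∀ i, IsDiscTest (fun x => Complex.exp (g i x * Complex.I) - 1) A := fun i =>
    hA₀ i A (hA ⟨i, rfl⟩)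
  have := h.tendsto_integral_prod_rescaled hk hq hq1 hf
  simp_rw [← integral_intensity (tendsto_prod_one_div hq hq1).2, Complex.exp_sum] at this
  refine this.congr fun n => integral_congr_ae (Eventually.of_forall fun ω => ?_)
  simp only [integral_pointProcess, add_sub_cancel]
  rw [Complex.ofReal_sum, Finset.sum_mul, Complex.exp_sum]
  refine Finset.prod_congr rfl fun i _ => ?_
  rw [Complex.ofReal_sum, Finset.sum_mul, Complex.exp_sum]

/-- The characteristic functional of independent Poisson processes. -/
theorem integral_exp_poisson {Ω : Type*} [MeasurableSpace Ω] {P : Measure Ω}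
    [IsProbabilityMeasure P] {ν : Measure ℝ} [IsLocallyFiniteMeasure ν] {ℓ : ℕ}
    {Z : Fin ℓ → Ω → LFMeasure} (hZ : ∀ i, IsPoissonProcess (Z i) ν P) (hind : iIndepFun Z P)
    (g : Fin ℓ → C_c(ℝ, ℝ)) :
    ∫ ω, Complex.exp ((∑ i, ∫ x, g i x ∂(Z i ω).toMeasure : ℝ) * Complex.I) ∂P
      = ∏ i, Complex.exp (∫ x, (Complex.exp (g i x * Complex.I) - 1) ∂ν) := by
  simp_rw [← fun i => (hZ i).characteristic (g i)]
  have hm : ∀ i, Measurable fun μ : LFMeasure =>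
      Complex.exp ((∫ x, g i x ∂μ.toMeasure : ℝ) * Complex.I) := fun i =>
    (show Continuous fun r : ℝ => Complex.exp (r * Complex.I) by fun_prop).measurable.comp
      (LFMeasure.measurable_integral (g i))
  rw [← hind.integral_fun_prod_comp (fun i => (hZ i).aemeasurable)
    (fun i => (hm i).aestronglyMeasurable)]
  refine integral_congr_ae (Eventually.of_forall fun ω => ?_)
  simp only
  rw [Complex.ofReal_sum, Finset.sum_mul, Complex.exp_sum]

/-- Independent exponential variables agree almost surely with a family of measurable nonnegative
ones. -/
theorem exists_isExpFamily {ι Ω : Type*} [Countable ι] [MeasurableSpace Ω] {P : Measure Ω}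
    {W : ι → Ω → ℝ}
    (hW : ∀ v, HasLaw (W v) (expMeasure 1) P) (hindep : iIndepFun W P) :
    ∃ W' : ι → Ω → ℝ, IsExpFamily W' P ∧ ∀ᵐ ω ∂P, ∀ v, W v ω = W' v ω := by
  let W' : ι → Ω → ℝ := fun v ω => max ((hW v).aemeasurable.mk _ ω) 0
  have hneg : ∀ᵐ x ∂(expMeasure 1), 0 ≤ x := by
    rw [ae_iff]
    have e : {x : ℝ | ¬ 0 ≤ x} = Set.Iio 0 := by ext; simp
    rw [e, expMeasure_eq_withDensity, withDensity_apply _ measurableSet_Iio]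
    exact lintegral_exponentialPDF_of_nonpos le_rfl
  have hae : ∀ v, W v =ᵐ[P] W' v := by
    intro v
    have h1 : ∀ᵐ ω ∂P, 0 ≤ W v ω := by
      rw [← (hW v).map_eq] at hneg
      exact ae_of_ae_map (hW v).aemeasurable hneg
    filter_upwards [(hW v).aemeasurable.ae_eq_mk, h1] with ω h2 h3
    simp only [W']
    rw [← h2, max_eq_left h3]
  refine ⟨W', ⟨fun v => (hW v).aemeasurable.measurable_mk.max measurable_const,
    fun v ω => le_max_right _ _, fun v => (hW v).congr (hae v).symm, hindep.congr hae⟩,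
    ae_all_iff.2 hae⟩

end Fragmentation

open Fragmentation in
/-- Let `W v`, for `v` in the `k`-ary tree, be independent standard exponential variables and
`q = k ^ (-α)`. Then `N_n` converges in distribution, for the vague topology, to the Poisson process
with intensity `e ^ (-s) ds / φ_∞(q)`, and `(N_n, …, N_{n+ℓ-1})` converges in distribution to a
vector of `ℓ` independent such processes. -/
theorem theoremC (k : ℕ) (hk : 2 ≤ k) (α : ℝ) (hα : 0 < α)
    {Ω : Type*} [MeasurableSpace Ω] (P : Measure Ω) [IsProbabilityMeasure P]
    (W : List (Fin k) → Ω → ℝ)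
    (hW : ∀ v, HasLaw (W v) (expMeasure 1) P) (hindep : iIndepFun W P)
    {Ω' : Type*} [MeasurableSpace Ω'] (P' : Measure Ω') [IsProbabilityMeasure P'] :
    (∀ Z : Ω' → LFMeasure, IsPoissonProcess Z (intensity ((k : ℝ) ^ (-α))) P' →
      TendstoInDistribution
        (fun (n : ℕ) ω => pointProcess ((k : ℝ) ^ (-α)) (fun v => W v ω) n)
        atTop Z (fun _ => P) P') ∧
    (∀ ℓ : ℕ, 1 ≤ ℓ → ∀ Z : Fin ℓ → Ω' → LFMeasure,
      (∀ i, IsPoissonProcess (Z i) (intensity ((k : ℝ) ^ (-α))) P') → iIndepFun Z P' →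
      TendstoInDistribution
        (fun (n : ℕ) ω (i : Fin ℓ) =>
          pointProcess ((k : ℝ) ^ (-α)) (fun v => W v ω) (n + i))
        atTop (fun ω i => Z i ω) (fun _ => P) P') := by
  set q : ℝ := (k : ℝ) ^ (-α) with hq_def
  have hk1 : (1 : ℝ) < k := by exact_mod_cast hk
  have hq : 0 < q := Real.rpow_pos_of_pos (by linarith) _
  have hq1 : q < 1 := Real.rpow_lt_one_of_one_lt_of_neg hk1 (by linarith)
  obtain ⟨W', hW', hae⟩ := exists_isExpFamily hW hindep
  have hpp : ∀ᵐ ω ∂P, ∀ n,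
      pointProcess q (fun v => W' v ω) n = pointProcess q (fun v => W v ω) n := by
    filter_upwards [hae] with ω hω n
    simp_rw [hω]
  have hmeas : ∀ n, AEMeasurable (fun ω => pointProcess q (fun v => W v ω) n) P := fun n =>
    (hW'.measurable_pointProcess hq n).aemeasurable.congr (hpp.mono fun ω hω => hω n)
  have hchar : ∀ {ℓ : ℕ} (g : Fin ℓ → C_c(ℝ, ℝ)),
      Tendsto (fun n : ℕ => ∫ ω, Complex.exp ((∑ i : Fin ℓ,
        ∫ x, g i x ∂(pointProcess q (fun v => W v ω) (n + i)).toMeasure : ℝ) * Complex.I) ∂P) atTop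
      (𝓝 (∏ i, Complex.exp (∫ x, (Complex.exp (g i x * Complex.I) - 1) ∂(intensity q)))) := by
    intro ℓ g
    refine (hW'.tendsto_characteristic hk hq hq1 g).congr fun n => ?_
    refine integral_congr_ae (hpp.mono fun ω hω => ?_)
    simp only [hω]
  constructor
  · intro Z hZ
    refine tendstoInDistribution_of_characteristic (ℓ := 1) (e := fun μ _ => μ)
      (Homeomorph.funUnique (Fin 1) LFMeasure).symm.isInducing _ _ hmeas hZ.aemeasurable fun g => ?_
    have h1 := hchar g
    have h2 := hZ.characteristic (g 0)
    simp only [Fin.prod_univ_one, Fin.sum_univ_one, Fin.val_zero, add_zero] at h1 ⊢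
    rwa [h2]
  · intro ℓ _ Z hZ hind
    refine tendstoInDistribution_of_characteristic IsInducing.id _ _
      (fun n => aemeasurable_pi_iff.2 fun i => hmeas _)
      (aemeasurable_pi_iff.2 fun i => (hZ i).aemeasurable) fun g => ?_
    have h1 := hchar g
    rw [← integral_exp_poisson hZ hind g] at h1
    exact h1
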